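/- **Setting.** For integers $m,n\ge 1$ let $T_{m,n}$ be the toroidal Aztec rectangle graph: its vertices are the pairs $(x,y)\in \mathbb Z/2n\times\mathbb Z/2m$ with $x+y$ odd, two of them being adjacent when they differ by $(\pm1,\pm1)$ (this is the Aztec rectangle graph $AR_{m,n}$ with opposite sides of the boundary identified). It is a toroidal quotient of the square grid graph $\mathcal G$ with vertices $(x,y)\in\mathbb Z^2$, $x+y$ odd, whose vertices are called white if $x$ is even and black if $x$ is odd. Let $M(G)$ be the number of perfect matchings of $G$. For $k,l\ge 0$, a hole of shape $O_{k,l}$ (odd Aztec rectangle) is a set of vertices of $\mathcal G$ of the form $\{(x,y): a\le x\le a+2l,\ b\le y\le b+2k,\ x+y \text{ odd}\}$ with $(a,b)$ a vertex of $\mathcal G$; the majority of its vertices have the colour of $(a,b)$, and its centre is $(a+l,b+k)$. The charge $q(O)$ of a hole $O$ is its number of white vertices minus its number of black vertices (so $q(O)=\pm(k+l+1)$). A monomer is a hole of shape $O_{0,0}$. Let $d(O,O')$ be the Euclidean distance between the centres of two holes, measured so that the edges of $\mathcal G$ have length $1$. **Correlation.** For holes $O_1,\dots,O_r$ of total charge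 $0$, $$\omega(O_1,\dots,O_r)=\lim_{N\to\infty}\frac{M(T_{N,N}\setminus O_1\cup\dots\cup O_r)}{M(T_{N,N})}.$$ The correlation of a monomer is $\omega(\circ)=\omega(\bullet)=\sqrt{\lim\ \omega(\circ,\bullet)\,d(\circ,\bullet)^{1/2}}$, where $\circ$ is a white and $\bullet$ a black monomer, in the limit of large separation. The correlation of a single hole $O$ is $$\omega(O)=\lim\ \frac{\omega(P_0,P_1,\dots,P_s)}{\omega(\circ)^{s}\prod_{0\le i<j\le s}d(P_i,P_j)^{\frac12q(P_i)q(P_j)}},\qquad P_0=O,\ s=|q(O)|,$$ where $P_1,\dots,P_s$ are monomers of the colour opposite to the majority colour of $O$, and all the mutual distances of $P_0,\dots,P_s$ tend to infinity. **Electrostatic conjecture** (for odd Aztec rectangular holes). For holes $O_1,\dots,O_r$ of fixed shapes and majority colours and of total charge $0$, in the limit where all their mutual distances tend to infinity, the correlation $\omega(O_1,\dots,O_r)$ exists and $$\omega(O_1,\dots,O_r)\sim\prod_{i=1}^r\omega(O_i)\prod_{1\le i<j\le r}d(O_i,O_j)^{\frac12q(O_i)q(O_j)}.$$ **Corollary (dual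 of the Aztec diamond theorem).** Assume the electrostatic conjecture. Then for every $n\ge0$ the limits that define the correlations of the holes of shape $O_{n,n}$ and $O_{0,2n}$ exist, and $$\omega(O_{n,n})=2^{-\frac{n^2}{2}}\,\omega(O_{0,2n}),$$ whatever the positions and the majority colours of the two holes. -/

import Mathlib

open Filter Topology

noncomputable section

namespace AztecWindow

/-! ### The toroidal Aztec rectangle graph

The squares of a chessboard are indexed by `(x, y) : ℤ × ℤ`, with the square `(0, 0)` black. The
vertices of the Aztec rectangle graph `AR_{m,n}` are the squares with `x + y` odd of the board
`0 ≤ x ≤ 2n`, `0 ≤ y ≤ 2m` (height parameter `m`, width parameter `n`), two of them being adjacent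
when they share a corner. Identifying opposite sides of the boundary means reading `x` modulo `2n`
and `y` modulo `2m`. -/

/-- All squares of the torus, two of them being joined when they differ by `(±1, ±1)`. -/
def cornerGraph (m n : ℕ) : SimpleGraph (ZMod (2 * n) × ZMod (2 * m)) where
  Adj u v := u ≠ v ∧ (v.1 = u.1 + 1 ∨ v.1 = u.1 - 1) ∧ (v.2 = u.2 + 1 ∨ v.2 = u.2 - 1)
  symm := ⟨by
    rintro u v ⟨h, h₁, h₂⟩
    refine ⟨h.symm, ?_, ?_⟩
    · rcases h₁ with h₁ | h₁ <;> rw [h₁] <;> simp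
    · rcases h₂ with h₂ | h₂ <;> rw [h₂] <;> simp⟩
  loopless := ⟨fun _ h => h.1 rfl⟩

/-- The projection of the plane onto the torus. -/
def toTorus (m n : ℕ) (p : ℤ × ℤ) : ZMod (2 * n) × ZMod (2 * m) := ((p.1 : ℤ), (p.2 : ℤ))

/-- The squares of the (infinite) board that are vertices of the square grid graph. -/
def gridVertices : Set (ℤ × ℤ) := {p | Odd (p.1 + p.2)}

/-- The graph `T_{m,n} ∖ H`: the toroidal Aztec rectangle graph `T_{m,n}` from which the vertices
in (the image of) a set `H` have been removed. Thus `T_{m,n}` itself is `torusMinus m n ∅`. -/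
def torusMinus (m n : ℕ) (H : Set (ℤ × ℤ)) :
    SimpleGraph ↥(toTorus m n '' gridVertices \ toTorus m n '' H) :=
  (cornerGraph m n).induce (toTorus m n '' gridVertices \ toTorus m n '' H)

/-- `M(G)`: the number of perfect matchings of a (finite) graph. -/
def numPerfectMatchings {V : Type*} (G : SimpleGraph V) : ℕ :=
  Nat.card {M : G.Subgraph // M.IsPerfectMatching}

/-! ### Odd Aztec rectangular holes -/

/-- The two colour classes of the bipartite square grid graph: a vertex `(x, y)` (with `x + y` odd)
is white if `x` is even and black if `x` is odd. -/
inductive Color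
  | white
  | black

/-- The reference vertex of each colour. -/
def Color.base : Color → ℤ × ℤ
  | white => (0, 1)
  | black => (1, 0)

/-- The opposite colour. -/
def Color.opp : Color → Color
  | white => black
  | black => white

/-- The kind of an odd Aztec rectangular hole: its shape `O_{k,l}` (`k` is the height parameter and
`l` the width parameter) together with the colour of the majority of its vertices. -/
structure HoleKind where
  color : Color
  k : ℕ
  l : ℕ

/-- An odd Aztec rectangular hole in the square grid; `pos` ranges freely over the integer pairs and
fixes its location through its lower left vertex, see `Hole.corner`. -/
structure Hole extends HoleKind where
  pos : ℤ × ℤ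

/-- The hole of a given kind at a given position. -/
def HoleKind.place (τ : HoleKind) (x : ℤ × ℤ) : Hole := ⟨τ, x⟩

/-- The lower left vertex of a hole: an arbitrary grid vertex of the majority colour. -/
def Hole.corner (O : Hole) : ℤ × ℤ :=
  (2 * O.pos.1 + O.color.base.1, 2 * O.pos.2 + O.color.base.2)

/-- The centre of a hole. -/
def Hole.center (O : Hole) : ℤ × ℤ := (O.corner.1 + O.l, O.corner.2 + O.k)

/-- The vertices of a hole of shape `O_{k,l}`: the squares of the same colour as the corners in a
chessboard with `2k+1` rows and `2l+1` columns. -/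
def Hole.vertices (O : Hole) : Set (ℤ × ℤ) :=
  {p | O.corner.1 ≤ p.1 ∧ p.1 ≤ O.corner.1 + 2 * O.l ∧
    O.corner.2 ≤ p.2 ∧ p.2 ≤ O.corner.2 + 2 * O.k ∧ Odd (p.1 + p.2)}

/-- The charge of a hole: its number of white vertices minus its number of black vertices. -/
def Hole.charge (O : Hole) : ℤ :=
  ((O.vertices ∩ {p | Even p.1}).ncard : ℤ) - ((O.vertices ∩ {p | Odd p.1}).ncard : ℤ)

/-- The Euclidean distance between the centres of two holes, in the scale in which the edges of the
square grid graph (the vectors `(±1, ±1)`) have length `1`. -/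
def Hole.dist (O P : Hole) : ℝ :=
  √((((O.center.1 - P.center.1 : ℤ) : ℝ) ^ 2 + ((O.center.2 - P.center.2 : ℤ) : ℝ) ^ 2) / 2)

/-- A monomer: a hole consisting of a single vertex. -/
def monomer (c : Color) (x : ℤ × ℤ) : Hole := ⟨⟨c, 0, 0⟩, x⟩

/-! ### Correlations -/

/-- The finite size correlation `ω_{m,n}(O_1, …, O_r)`. -/
def finiteCorrelation (m n : ℕ) {r : ℕ} (O : Fin r → Hole) : ℝ :=
  (numPerfectMatchings (torusMinus m n (⋃ i, (O i).vertices)) : ℝ) /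
    numPerfectMatchings (torusMinus m n ∅)

/-- `w` is the correlation of the neutral collection of holes `O_1, …, O_r`. -/
def HasNeutralCorrelation {r : ℕ} (O : Fin r → Hole) (w : ℝ) : Prop :=
  Tendsto (fun N : ℕ => finiteCorrelation N N O) atTop (𝓝 w)

/-- The correlation `ω(O_1, …, O_r)` of a collection of holes of total charge zero. -/
def neutralCorrelation {r : ℕ} (O : Fin r → Hole) : ℝ :=
  limUnder atTop (fun N : ℕ => finiteCorrelation N N O)

/-- The filter on `r`-tuples of positions that describes large mutual separations: all the pairwise
distances tend to infinity. -/
def farApart (r : ℕ) : Filter (Fin r → ℤ × ℤ) :=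
  ⨅ (i : Fin r) (j : Fin r) (_ : i ≠ j), comap (fun x => Dist.dist (x i) (x j)) atTop

/-- The Coulomb factor `∏_{i<j} d(O_i, O_j) ^ (q(O_i) q(O_j) / 2)` of a collection of holes. -/
def coulomb {r : ℕ} (O : Fin r → Hole) : ℝ :=
  ∏ i : Fin r, ∏ j ∈ Finset.Ioi i,
    (O i).dist (O j) ^ ((((O i).charge * (O j).charge : ℤ) : ℝ) / 2)

/-- The correlation `ω(∘) = ω(•)` of a single monomer, normalized by the requirement
`ω(∘, •) ∼ ω(∘) ω(•) d(∘, •) ^ (-1/2)` at large separation. -/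
def monomerCorrelation : ℝ :=
  √(limUnder (farApart 2) fun x =>
    neutralCorrelation ![monomer .white (x 0), monomer .black (x 1)] *
      (monomer .white (x 0)).dist (monomer .black (x 1)) ^ ((1 : ℝ) / 2))

/-- The hole `O`, neutralized by `|q(O)|` monomers of the opposite colour at positions `x`. -/
def neutralized (O : Hole) (x : Fin O.charge.natAbs → ℤ × ℤ) : Fin (O.charge.natAbs + 1) → Hole :=
  Fin.cons O fun i => monomer O.color.opp (x i)

/-- The neutralizing monomers recede from `O` and from one another. -/
def receding (O : Hole) : Filter (Fin O.charge.natAbs → ℤ × ℤ) :=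
  comap (fun x => (Fin.cons O.pos x : Fin (O.charge.natAbs + 1) → ℤ × ℤ))
    (farApart (O.charge.natAbs + 1))

/-- The correlation of the neutralized hole, divided by the correlations of the neutralizing
monomers and by the Coulomb factor of the collection. -/
def normalizedCorrelation (O : Hole) (x : Fin O.charge.natAbs → ℤ × ℤ) : ℝ :=
  neutralCorrelation (neutralized O x) /
    (monomerCorrelation ^ O.charge.natAbs * coulomb (neutralized O x))

/-- `w` is the correlation of the single (charged) hole `O`: the limits that define it exist, and
the limit is `w`. -/
def HasCorrelation (O : Hole) (w : ℝ) : Prop :=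
  (∀ᶠ x in receding O, ∃ c, HasNeutralCorrelation (neutralized O x) c) ∧
    Tendsto (normalizedCorrelation O) (receding O) (𝓝 w)

/-- The correlation `ω(O)` of a single (charged) hole. -/
def correlation (O : Hole) : ℝ := limUnder (receding O) (normalizedCorrelation O)

/-- The electrostatic conjecture for odd Aztec rectangular holes of total charge zero. For holes of
fixed kinds, in the limit of large mutual separations, the correlation `ω(O_1, …, O_r)` exists and
`ω(O_1, …, O_r) ∼ ∏_i ω(O_i) · ∏_{i<j} d(O_i, O_j) ^ (q(O_i) q(O_j) / 2)`. -/
def ElectrostaticConjecture : Prop :=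
  ∀ (r : ℕ) (τ : Fin r → HoleKind), ∑ i, ((τ i).place 0).charge = 0 →
    (∀ᶠ x in farApart r, ∃ w, HasNeutralCorrelation (fun i => (τ i).place (x i)) w) ∧
    Tendsto (fun x : Fin r → ℤ × ℤ =>
        neutralCorrelation (fun i => (τ i).place (x i)) /
          ((∏ i, correlation ((τ i).place (x i))) * coulomb (fun i => (τ i).place (x i))))
      (farApart r) (𝓝 1)

end AztecWindow

end

noncomputable section

namespace AztecWindow

/-! ### Complementation for graphs covered by four-cycles

The edges of a four-cycle ("cell") with opposite vertices `N, S` and `E, W` are encoded by pairs of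
booleans: the first one selects `N` or `S`, the second one `E` or `W`. -/

section Cells

/-! The engine is complementation. The four-cycles centred at the points with both coordinates of a
fixed parity partition the edges of the torus, and every vertex lies in two of them. A perfect
matching therefore assigns each vertex to one of its two cells, and the number of matchings is the
sum over assignments of a product of cell weights. Replacing the part assigned to each cell by its
complement changes the weights only by powers of two whose total depends on the removed vertices
alone.

Take a block of k+1 rows and l+1 columns of cells. One hole consists of all the north and south
vertices of the block and its inner east and west vertices, the other of all the east and west
vertices and the inner north and south ones. They have shapes O_{k+1,l} and O_{k,l+1}, the same
centre and opposite charges, and complementation outside the block exchanges them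
(`cellPartition_complementary`, `planeComplementary_oddRect`).

Since a reshaped hole changes the sign of its charge, it is accompanied by its mirror image in the
diagonal, which has the opposite charge and the same correlation. For large N the two reshapings
together multiply the number of matchings by exactly 2^(l-k) (`numPerfectMatchings_oddRect`). The
Coulomb factor of the pair does not change, so the conjecture gives ω(O_{k,l+1})² = 2^(l-k)
ω(O_{k+1,l})² (`sq_correlation_mul_pow`). Flattening O_{n,n} one row at a time accumulates the
factor 2^(n²), and nonnegativity allows a square root.

The conjecture is also what makes single-hole correlations meaningful: it forces them to be nonzero,
identifies the monomer with its normalization, and yields the limits in their definition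
(`correlation_monomer`, `hasCorrelation`). -/

def rowSum (μ : Bool → Bool → Bool) (a : Bool) : ℕ := (μ a true).toNat + (μ a false).toNat

def colSum (μ : Bool → Bool → Bool) (b : Bool) : ℕ := (μ true b).toNat + (μ false b).toNat

/-- The edge set `μ` of a cell covers, exactly once each, the vertices of the cell selected by `p`,
and no others. The vertices `N, S` are `p true true`, `p true false`, and the vertices `E, W` are
`p false true`, `p false false`. -/
def Realizes (μ p : Bool → Bool → Bool) : Prop :=
  ∀ a, rowSum μ a = (p true a).toNat ∧ colSum μ a = (p false a).toNat

instance (μ p : Bool → Bool → Bool) : Decidable (Realizes μ p) := by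
  unfold Realizes; infer_instance

/-- The number of perfect matchings of the subgraph of a cell induced by the vertices in `p`. -/
def cellWeight (p : Bool → Bool → Bool) : ℕ :=
  (Finset.univ.filter fun μ => Realizes μ p).card

def boolMatrix (a b c d : Bool) : Bool → Bool → Bool
  | true, true => a
  | true, false => b
  | false, true => c
  | false, false => d

theorem boolMatrix_eta (p : Bool → Bool → Bool) :
    p = boolMatrix (p true true) (p true false) (p false true) (p false false) := by
  funext a b
  cases a <;> cases b <;> rfl

theorem cellWeight_eq (p : Bool → Bool → Bool) :
    cellWeight p = ((Finset.univ : Finset (Bool × Bool × Bool × Bool)).filter fun q =>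
      Realizes (boolMatrix q.1 q.2.1 q.2.2.1 q.2.2.2) p).card := by
  symm
  refine Finset.card_bij' (fun q _ => boolMatrix q.1 q.2.1 q.2.2.1 q.2.2.2)
    (fun μ _ => (μ true true, μ true false, μ false true, μ false false)) ?_ ?_ ?_ ?_
  · intro q hq
    simpa using hq
  · intro μ hμ
    simpa [← boolMatrix_eta] using hμ
  · intro q _
    rfl
  · intro μ _
    exact (boolMatrix_eta μ).symm

/-- The weight is 1 for the empty set, 2 for all four vertices, 1 for two adjacent vertices and 0
otherwise. Complementation exchanges the first two and preserves the other two classes; counting N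
and S in the exponent treats all cases uniformly. -/
theorem cellWeight_compl (p : Bool → Bool → Bool) :
    cellWeight (fun a b => !p a b) * 2 ^ ((p true true).toNat + (p true false).toNat) =
      2 * cellWeight p := by
  rw [cellWeight_eq, cellWeight_eq, boolMatrix_eta p]
  generalize p true true = a
  generalize p true false = b
  generalize p false true = c
  generalize p false false = d
  revert a b c d
  decide

/-- Every edge of a cell joins one of N, S to one of E, W, so a matchable set contains equally many
of both kinds. -/
theorem eq_false_of_cellWeight_ne_zero {p : Bool → Bool → Bool} (hp : cellWeight p ≠ 0)
    (h : (p true true = false ∧ p true false = false) ∨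
      (p false true = false ∧ p false false = false)) : p = fun _ _ => false := by
  have key : ∀ a b c d : Bool, cellWeight (boolMatrix a b c d) ≠ 0 →
      ((a = false ∧ b = false) ∨ (c = false ∧ d = false)) →
      (a = false ∧ b = false ∧ c = false ∧ d = false) := by
    intro a b c d
    rw [cellWeight_eq]
    revert a b c d
    decide
  rw [boolMatrix_eta p] at hp
  obtain ⟨h1, h2, h3, h4⟩ := key _ _ _ _ hp h
  funext a b
  cases a <;> cases b <;> assumption

/-! ### Matchings and states on a whole system of cells -/

variable {C : Type*}

open Classical in
/-- `m` selects edges in every cell such that each vertex is covered once, except for the removed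
ones, which are not covered. The north vertex of the cell `c` is the south vertex of `σ c`, and its
east vertex is the west vertex of `ρ c`; they are removed when `X c`, respectively `Y c`, holds. -/
def IsCellMatching (σ ρ : Equiv.Perm C) (X Y : C → Prop) (m : C → Bool → Bool → Bool) : Prop :=
  ∀ c, rowSum (m c) true + rowSum (m (σ c)) false = (if X c then 0 else 1) ∧
    colSum (m c) true + colSum (m (ρ c)) false = (if Y c then 0 else 1)

open Classical in
/-- `A` assigns every vertex that is not removed to one of the two cells that contain it. -/
def IsCellState (σ ρ : Equiv.Perm C) (X Y : C → Prop) (A : C → Bool → Bool → Bool) : Prop :=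
  ∀ c, (A c true true).toNat + (A (σ c) true false).toNat = (if X c then 0 else 1) ∧
    (A c false true).toNat + (A (ρ c) false false).toNat = (if Y c then 0 else 1)

def cellPartition (σ ρ : Equiv.Perm C) (X Y : C → Prop) : ℕ :=
  Nat.card {m : C → Bool → Bool → Bool // IsCellMatching σ ρ X Y m}

open Classical in
-- Matchings are sorted by which of its two cells covers each vertex. Once this is prescribed, the
-- cells are matched independently.
theorem cellPartition_eq_sum [Fintype C] [DecidableEq C] (σ ρ : Equiv.Perm C) (X Y : C → Prop) :
    cellPartition σ ρ X Y =
      ∑ A ∈ Finset.univ.filter (IsCellState σ ρ X Y), ∏ c, cellWeight (A c) := by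
  rw [cellPartition, Nat.card_eq_fintype_card, Fintype.card_subtype]
  -- `Φ m` records, for every cell, which of its vertices are covered by an edge of that cell.
  let Φ : (C → Bool → Bool → Bool) → (C → Bool → Bool → Bool) := fun m c i a =>
    if i then decide (rowSum (m c) a = 1) else decide (colSum (m c) a = 1)
  have hΦ : ∀ m, IsCellMatching σ ρ X Y m → ∀ c, Realizes (m c) (Φ m c) := by
    intro m hm c a
    have h1 := (hm c).1
    have h2 := (hm c).2
    have h3 := (hm (σ.symm c)).1
    have h4 := (hm (ρ.symm c)).2
    rw [Equiv.apply_symm_apply] at h3 h4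
    have toNat_decide : ∀ k : ℕ, k ≤ 1 → k = (decide (k = 1)).toNat := by
      intro k hk
      interval_cases k <;> rfl
    have hr : rowSum (m c) a ≤ 1 := by
      cases a
      · split_ifs at h3 <;> omega
      · split_ifs at h1 <;> omega
    have hc : colSum (m c) a ≤ 1 := by
      cases a
      · split_ifs at h4 <;> omega
      · split_ifs at h2 <;> omega
    exact ⟨toNat_decide _ hr, toNat_decide _ hc⟩
  rw [Finset.card_eq_sum_card_fiberwise (f := Φ)
    (t := Finset.univ.filter (IsCellState σ ρ X Y))]
  · refine Finset.sum_congr rfl fun A hA => ?_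
    rw [Finset.mem_filter] at hA
    have hA := hA.2
    simp only [cellWeight]
    -- The fibre of `Φ` over `A` is a product over the cells of the sets counted by `cellWeight`.
    rw [← Fintype.card_piFinset]
    congr 1
    ext m
    simp only [Finset.mem_filter, Finset.mem_univ, true_and, Fintype.mem_piFinset]
    constructor
    · rintro ⟨hm, rfl⟩
      exact hΦ m hm
    · intro h
      refine ⟨fun c => ?_, ?_⟩
      · rw [(h c true).1, (h (σ c) false).1, (h c true).2, (h (ρ c) false).2]
        exact hA c
      · funext c i a
        have h1 := h c a
        cases i
        · simp only [Φ, h1.2]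
          cases A c false a <;> simp
        · simp only [Φ, h1.1]
          cases A c true a <;> simp
  · intro m hm
    simp only [Finset.coe_filter, Finset.mem_univ, true_and, Set.mem_ofPred_eq] at hm ⊢
    intro c
    have h := hΦ m hm
    rw [← (h c true).1, ← (h (σ c) false).1, ← (h c true).2, ← (h (ρ c) false).2]
    exact hm c

/-- The removed vertices `(X, Y)` and `(X', Y')` are complementary with respect to the cells in
`D`. -/
structure Complementary (σ ρ : Equiv.Perm C) (D X Y X' Y' : C → Prop) : Prop where
  or_north : ∀ c, X c ∨ X' c ↔ D c ∨ D (σ c)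
  and_north : ∀ c, X c ∧ X' c ↔ D c ∧ D (σ c)
  or_east : ∀ c, Y c ∨ Y' c ↔ D c ∨ D (ρ c)
  and_east : ∀ c, Y c ∧ Y' c ↔ D c ∧ D (ρ c)
  mem : ∀ c, D c →
    ((X c ∧ X (σ.symm c)) ∧ (Y' c ∧ Y' (ρ.symm c))) ∨
    ((X' c ∧ X' (σ.symm c)) ∧ (Y c ∧ Y (ρ.symm c)))

theorem Complementary.symm {σ ρ : Equiv.Perm C} {D X Y X' Y' : C → Prop}
    (h : Complementary σ ρ D X Y X' Y') : Complementary σ ρ D X' Y' X Y where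
  or_north c := by rw [← h.or_north c, or_comm]
  and_north c := by rw [← h.and_north c, and_comm]
  or_east c := by rw [← h.or_east c, or_comm]
  and_east c := by rw [← h.and_east c, and_comm]
  mem c hc := (h.mem c hc).symm

open Classical in
/-- The complementary assignment of vertices to cells. -/
def complState (D : C → Prop) (A : C → Bool → Bool → Bool) : C → Bool → Bool → Bool :=
  fun c i a => if D c then false else !A c i a

open Classical in
-- Each cell outside `D` contributes one instance of `cellWeight_compl`, hence one factor 2; a cell
-- of `D` is empty on both sides and has weight 1.
theorem prod_cellWeight_complState [Fintype C] (D : C → Prop) {A : C → Bool → Bool → Bool}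
    (hA : ∀ c, D c → A c = fun _ _ => false) :
    (∏ c, cellWeight (complState D A c)) *
      2 ^ (∑ c, ((A c true true).toNat + (A c true false).toNat)) =
      2 ^ (Finset.univ.filter fun c => ¬ D c).card * ∏ c, cellWeight (A c) := by
  rw [← Finset.prod_pow_eq_pow_sum, ← Finset.prod_mul_distrib, Finset.card_filter,
    ← Finset.prod_pow_eq_pow_sum, ← Finset.prod_mul_distrib]
  refine Finset.prod_congr rfl fun c _ => ?_
  by_cases hc : D c
  · have h1 : complState D A c = fun _ _ => false := by
      funext i a
      simp [complState, hc]
    simp [h1, hA c hc, hc]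
  · have h1 : complState D A c = fun i a => !A c i a := by
      funext i a
      simp [complState, hc]
    rw [h1, cellWeight_compl]
    simp [hc]

/-- Two opposite vertices of a cell of `D` are removed, so they are not assigned to it; the balance
of a cell of nonzero weight then excludes the other two. -/
theorem IsCellState.eq_false_of_mem {σ ρ : Equiv.Perm C} {D X Y X' Y' : C → Prop}
    (h : Complementary σ ρ D X Y X' Y') {A : C → Bool → Bool → Bool}
    (hA : IsCellState σ ρ X Y A) (hw : ∀ c, cellWeight (A c) ≠ 0) (c : C) (hc : D c) :
    A c = fun _ _ => false := by
  refine eq_false_of_cellWeight_ne_zero (hw c) ?_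
  have h1 := (hA c).1
  have h2 := (hA c).2
  have h3 := (hA (σ.symm c)).1
  have h4 := (hA (ρ.symm c)).2
  rw [Equiv.apply_symm_apply] at h3 h4
  have toNat_eq : ∀ b : Bool, b.toNat = 0 → b = false := by decide
  rcases h.mem c hc with ⟨⟨ha, hb⟩, -⟩ | ⟨-, ha, hb⟩
  · rw [if_pos ha] at h1
    rw [if_pos hb] at h3
    exact Or.inl ⟨toNat_eq _ (by omega), toNat_eq _ (by omega)⟩
  · rw [if_pos ha] at h2
    rw [if_pos hb] at h4
    exact Or.inr ⟨toNat_eq _ (by omega), toNat_eq _ (by omega)⟩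

/-- A vertex removed on neither side has both cells outside `D`, and they exchange it. A vertex
removed on one side only has one cell in `D`, and the other cell gains or loses it. A vertex removed
on both sides has both cells in `D` and stays unassigned. -/
theorem IsCellState.complState {σ ρ : Equiv.Perm C} {D X Y X' Y' : C → Prop}
    (h : Complementary σ ρ D X Y X' Y') {A : C → Bool → Bool → Bool}
    (hA : IsCellState σ ρ X Y A) (hD : ∀ c, D c → A c = fun _ _ => false) :
    IsCellState σ ρ X' Y' (complState D A) := by
  have aux : ∀ (x x' d d' : Prop) [Decidable x] [Decidable x'] [Decidable d] [Decidable d']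
      (p q : Bool), (x ∨ x' ↔ d ∨ d') → (x ∧ x' ↔ d ∧ d') → (d → p = false) → (d' → q = false) →
      p.toNat + q.toNat = (if x then 0 else 1) →
      (if d then false else !p).toNat + (if d' then false else !q).toNat =
        (if x' then 0 else 1) := by
    intro x x' d d' _ _ _ _ p q h1 h2 h3 h4 h5
    by_cases x <;> by_cases x' <;> by_cases d <;> by_cases d' <;> cases p <;> cases q <;>
      simp_all
  classical
  intro c
  have hf : ∀ c i a, D c → A c i a = false := fun c i a hc => by rw [hD c hc]
  exact ⟨aux _ _ _ _ _ _ (h.or_north c) (h.and_north c) (hf _ _ _) (hf _ _ _) (hA c).1,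
    aux _ _ _ _ _ _ (h.or_east c) (h.and_east c) (hf _ _ _) (hf _ _ _) (hA c).2⟩

theorem complState_complState {D : C → Prop} {A : C → Bool → Bool → Bool}
    (hD : ∀ c, D c → A c = fun _ _ => false) : complState D (complState D A) = A := by
  funext c i a
  by_cases hc : D c
  · simp [complState, hc, hD c hc]
  · simp [complState, hc]

open Classical in
-- Shifting the south terms by `σ` counts each remaining north or south vertex once, so the exponent
-- of two is the same for all states.
theorem IsCellState.sum_toNat [Fintype C] {σ ρ : Equiv.Perm C} {X Y : C → Prop}
    {A : C → Bool → Bool → Bool} (hA : IsCellState σ ρ X Y A) :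
    ∑ c, ((A c true true).toNat + (A c true false).toNat) =
      (Finset.univ.filter fun c => ¬ X c).card := by
  rw [Finset.sum_add_distrib, ← Equiv.sum_comp σ (fun c => (A c true false).toNat),
    ← Finset.sum_add_distrib, Finset.card_filter]
  refine Finset.sum_congr rfl fun c _ => ?_
  rw [(hA c).1]
  split_ifs <;> simp_all

open Classical in
/-- The complementation theorem. -/
theorem cellPartition_complementary [Fintype C] [DecidableEq C] {σ ρ : Equiv.Perm C} {D X Y X' Y' : C → Prop}
    (h : Complementary σ ρ D X Y X' Y') :
    cellPartition σ ρ X' Y' * 2 ^ (Finset.univ.filter fun c => ¬ X c).card =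
      2 ^ (Finset.univ.filter fun c => ¬ D c).card * cellPartition σ ρ X Y := by
  -- States with a cell of weight zero are discarded: only on the others are the cells of `D` known
  -- to be empty, which makes `complState D` an involution.
  have restrict : ∀ X Y : C → Prop, cellPartition σ ρ X Y =
      ∑ A ∈ Finset.univ.filter (fun A => IsCellState σ ρ X Y A ∧ ∀ c, cellWeight (A c) ≠ 0),
        ∏ c, cellWeight (A c) := by
    intro X Y
    rw [cellPartition_eq_sum]
    symm
    refine Finset.sum_subset ?_ ?_
    · intro A hA
      simp only [Finset.mem_filter, Finset.mem_univ, true_and] at hA ⊢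
      exact hA.1
    · intro A hA hA'
      simp only [Finset.mem_filter, Finset.mem_univ, true_and] at hA hA'
      push Not at hA'
      obtain ⟨c, hc⟩ := hA' hA
      exact Finset.prod_eq_zero (Finset.mem_univ c) hc
  have image : ∀ {X Y X' Y' : C → Prop}, Complementary σ ρ D X Y X' Y' →
      ∀ A, (IsCellState σ ρ X Y A ∧ ∀ c, cellWeight (A c) ≠ 0) →
      (IsCellState σ ρ X' Y' (complState D A) ∧ ∀ c, cellWeight (complState D A c) ≠ 0) := by
    intro X Y X' Y' h A ⟨hA, hw⟩
    have hD := hA.eq_false_of_mem h hw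
    refine ⟨hA.complState h hD, fun c hc => ?_⟩
    have h1 := prod_cellWeight_complState D hD
    rw [Finset.prod_eq_zero (Finset.mem_univ c) hc, zero_mul] at h1
    have h2 : ∏ c, cellWeight (A c) ≠ 0 := Finset.prod_ne_zero_iff.2 fun c _ => hw c
    have h3 := mul_ne_zero (pow_ne_zero (Finset.univ.filter fun c => ¬ D c).card
      (two_ne_zero (α := ℕ))) h2
    exact h3 h1.symm
  rw [restrict X' Y', restrict X Y, Finset.sum_mul, Finset.mul_sum]
  symm
  refine Finset.sum_bij' (fun A _ => complState D A) (fun A _ => complState D A) ?_ ?_ ?_ ?_ ?_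
  · intro A hA
    simp only [Finset.mem_filter, Finset.mem_univ, true_and] at hA ⊢
    exact image h A hA
  · intro A hA
    simp only [Finset.mem_filter, Finset.mem_univ, true_and] at hA ⊢
    exact image h.symm A hA
  · intro A hA
    simp only [Finset.mem_filter, Finset.mem_univ, true_and] at hA
    exact complState_complState (hA.1.eq_false_of_mem h hA.2)
  · intro A hA
    simp only [Finset.mem_filter, Finset.mem_univ, true_and] at hA
    exact complState_complState (hA.1.eq_false_of_mem h.symm hA.2)
  · intro A hA
    simp only [Finset.mem_filter, Finset.mem_univ, true_and] at hA
    rw [← prod_cellWeight_complState D (hA.1.eq_false_of_mem h hA.2), hA.1.sum_toNat]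

end Cells

/-! ### Perfect matchings as pairing relations -/

/-- `R` is the adjacency relation of a perfect matching of the subgraph of `G` induced by `S`. -/
structure IsPairing {V : Type*} (G : SimpleGraph V) (S : Set V) (R : V → V → Prop) : Prop where
  symm : ∀ u v, R u v → R v u
  adj : ∀ u v, R u v → G.Adj u v
  mem : ∀ u v, R u v → u ∈ S
  existsUnique : ∀ u ∈ S, ∃! v, R u v

theorem numPerfectMatchings_induce {V : Type*} (G : SimpleGraph V) (S : Set V) :
    numPerfectMatchings (G.induce S) = Nat.card {R : V → V → Prop // IsPairing G S R} := by
  refine Nat.card_congr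
    { toFun := fun M => ⟨fun u v => ∃ (hu : u ∈ S) (hv : v ∈ S), M.1.Adj ⟨u, hu⟩ ⟨v, hv⟩, ?_⟩
      invFun := fun R => ⟨{
        verts := Set.univ
        Adj := fun u v => R.1 u v
        adj_sub := fun {u v} h => R.2.adj u v h
        edge_vert := fun _ => Set.mem_univ _
        symm := ⟨fun u v h => R.2.symm u v h⟩ }, ?_⟩
      left_inv := ?_
      right_inv := ?_ }
  · refine ⟨?_, ?_, ?_, ?_⟩
    · rintro u v ⟨hu, hv, h⟩
      exact ⟨hv, hu, h.symm⟩
    · rintro u v ⟨hu, hv, h⟩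
      exact M.1.adj_sub h
    · rintro u v ⟨hu, hv, h⟩
      exact hu
    · intro u hu
      obtain ⟨v, hv, huniq⟩ := M.2.1 (M.2.2 ⟨u, hu⟩)
      refine ⟨v, ⟨hu, v.2, hv⟩, ?_⟩
      rintro w ⟨_, hw, h⟩
      exact congrArg Subtype.val (huniq ⟨w, hw⟩ h)
  · refine ⟨?_, fun v => Set.mem_univ v⟩
    rintro u -
    obtain ⟨v, hv, huniq⟩ := R.2.existsUnique u u.2
    refine ⟨⟨v, R.2.mem _ _ (R.2.symm _ _ hv)⟩, hv, ?_⟩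
    intro w hw
    exact Subtype.ext (huniq w hw)
  · intro M
    apply Subtype.ext
    ext u v
    · simpa using M.2.2 u
    · constructor
      · rintro ⟨_, _, h⟩
        exact h
      · intro h
        exact ⟨u.2, v.2, h⟩
  · intro R
    apply Subtype.ext
    funext u v
    apply propext
    constructor
    · rintro ⟨_, _, h⟩
      exact h
    · intro h
      exact ⟨R.2.mem _ _ h, R.2.mem _ _ (R.2.symm _ _ h), h⟩

theorem numPerfectMatchings_induce_congr {V : Type*} (G : SimpleGraph V) (e : V ≃ V)
    (he : ∀ u v, G.Adj (e u) (e v) ↔ G.Adj u v) (S S' : Set V) (hS : ∀ u, e u ∈ S' ↔ u ∈ S) :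
    numPerfectMatchings (G.induce S') = numPerfectMatchings (G.induce S) := by
  rw [numPerfectMatchings_induce, numPerfectMatchings_induce]
  refine Nat.card_congr ((e.symm.arrowCongr (e.symm.arrowCongr (Equiv.refl Prop))).subtypeEquiv ?_)
  intro R
  have hR : ∀ u v, (e.symm.arrowCongr (e.symm.arrowCongr (Equiv.refl Prop))) R u v =
      R (e u) (e v) := fun u v => rfl
  constructor
  · intro h
    refine ⟨?_, ?_, ?_, ?_⟩
    · intro u v
      rw [hR, hR]
      exact h.symm _ _
    · intro u v
      rw [hR, ← he]
      exact h.adj _ _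
    · intro u v
      rw [hR, ← hS]
      exact h.mem _ _
    · intro u hu
      obtain ⟨v, hv, huniq⟩ := h.existsUnique (e u) ((hS u).2 hu)
      refine ⟨e.symm v, ?_, ?_⟩
      · simpa [hR] using hv
      · intro w hw
        rw [hR] at hw
        rw [← huniq _ hw, Equiv.symm_apply_apply]
  · intro h
    have hR' : ∀ u v, R u v ↔ (e.symm.arrowCongr (e.symm.arrowCongr (Equiv.refl Prop))) R
        (e.symm u) (e.symm v) := fun u v => by rw [hR]; simp
    refine ⟨?_, ?_, ?_, ?_⟩
    · intro u v
      rw [hR', hR' v]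
      exact h.symm _ _
    · intro u v huv
      rw [hR'] at huv
      have := h.adj _ _ huv
      rw [← he] at this
      simpa using this
    · intro u v huv
      rw [hR'] at huv
      have := h.mem _ _ huv
      rw [← hS] at this
      simpa using this
    · intro u hu
      obtain ⟨v, hv, huniq⟩ := h.existsUnique (e.symm u) ((hS _).1 (by simpa using hu))
      refine ⟨e v, ?_, ?_⟩
      · simpa [hR] using hv
      · intro w hw
        rw [hR'] at hw
        rw [← huniq _ hw, Equiv.apply_symm_apply]

/-! ### The cells of the toroidal Aztec rectangle graph -/

section Torus

variable {N : ℕ}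

/-- The square torus. -/
abbrev Torus (N : ℕ) : Type := ZMod (2 * N) × ZMod (2 * N)

/-- The parity of a coordinate on the torus. -/
def par (N : ℕ) : ZMod (2 * N) →+* ZMod 2 := ZMod.castHom (dvd_mul_right 2 N) (ZMod 2)

theorem par_intCast (a : ℤ) : par N (a : ZMod (2 * N)) = (a : ZMod 2) := map_intCast _ a

theorem intCast_zmod_two_eq_iff (a b : ℤ) : (a : ZMod 2) = (b : ZMod 2) ↔ a % 2 = b % 2 :=
  ZMod.intCast_eq_intCast_iff' a b 2

theorem exists_toTorus (z : Torus N) : ∃ p, toTorus N N p = z := by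
  obtain ⟨a, ha⟩ := ZMod.intCast_surjective z.1
  obtain ⟨b, hb⟩ := ZMod.intCast_surjective z.2
  exact ⟨(a, b), Prod.ext ha hb⟩

theorem mem_image_gridVertices (z : Torus N) :
    z ∈ toTorus N N '' gridVertices ↔ par N z.1 + par N z.2 = 1 := by
  have key : ∀ p : ℤ × ℤ,
      par N (toTorus N N p).1 + par N (toTorus N N p).2 = 1 ↔ p ∈ gridVertices := by
    intro p
    simp only [toTorus, par_intCast, gridVertices, Set.mem_ofPred_eq, Int.odd_iff]
    rw [← Int.cast_add, ← Int.cast_one, intCast_zmod_two_eq_iff]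
    rfl
  constructor
  · rintro ⟨p, hp, rfl⟩
    exact (key p).2 hp
  · intro h
    obtain ⟨p, rfl⟩ := exists_toTorus z
    exact ⟨p, (key p).1 h, rfl⟩

/-- The centres of one of the two classes of cells. -/
abbrev Cell (N : ℕ) (ε : ZMod 2) : Type := {z : Torus N // par N z.1 = ε ∧ par N z.2 = ε}

theorem par_two : par N 2 = 0 := by
  rw [map_ofNat]
  rfl

def cellUp (N : ℕ) (ε : ZMod 2) : Equiv.Perm (Cell N ε) where
  toFun c := ⟨(c.1.1, c.1.2 + 2), c.2.1, by rw [map_add, par_two, add_zero]; exact c.2.2⟩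
  invFun c := ⟨(c.1.1, c.1.2 - 2), c.2.1, by rw [map_sub, par_two, sub_zero]; exact c.2.2⟩
  left_inv c := by simp
  right_inv c := by simp

def cellRight (N : ℕ) (ε : ZMod 2) : Equiv.Perm (Cell N ε) where
  toFun c := ⟨(c.1.1 + 2, c.1.2), by rw [map_add, par_two, add_zero]; exact c.2.1, c.2.2⟩
  invFun c := ⟨(c.1.1 - 2, c.1.2), by rw [map_sub, par_two, sub_zero]; exact c.2.1, c.2.2⟩
  left_inv c := by simp
  right_inv c := by simp

def boolSign (N : ℕ) (s : Bool) : ZMod (2 * N) := if s then 1 else -1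

theorem boolSign_true : boolSign N true = 1 := rfl

theorem boolSign_false : boolSign N false = -1 := rfl

/-- For `N = 1` the two signs coincide modulo 2; this is the source of the condition `2 ≤ N` below.
-/
theorem boolSign_injective (hN : 2 ≤ N) : Function.Injective (boolSign N) := by
  have h : (1 : ZMod (2 * N)) ≠ -1 := by
    intro h
    have h2 : ((2 : ℕ) : ZMod (2 * N)) = 0 := by
      push_cast
      linear_combination h
    rw [ZMod.natCast_eq_zero_iff] at h2
    have := Nat.le_of_dvd (by norm_num) h2
    omega
  intro s t hst
  cases s <;> cases t <;> simp_all [boolSign]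

/-- The north (`true`) and south (`false`) vertices of a cell. -/
def vertical {ε : ZMod 2} (c : Cell N ε) (a : Bool) : Torus N := (c.1.1, c.1.2 + boolSign N a)

/-- The east (`true`) and west (`false`) vertices of a cell. -/
def horizontal {ε : ZMod 2} (c : Cell N ε) (b : Bool) : Torus N := (c.1.1 + boolSign N b, c.1.2)

def diagonalNeighbor (u : Torus N) (i : Bool × Bool) : Torus N :=
  (u.1 + boolSign N i.1, u.2 + boolSign N i.2)

theorem diagonalNeighbor_injective (hN : 2 ≤ N) (u : Torus N) :
    Function.Injective (diagonalNeighbor u) := by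
  intro i j h
  simp only [diagonalNeighbor, Prod.mk.injEq, add_right_inj] at h
  exact Prod.ext (boolSign_injective hN h.1) (boolSign_injective hN h.2)

theorem cornerGraph_adj_iff (hN : 2 ≤ N) (u v : Torus N) :
    (cornerGraph N N).Adj u v ↔ ∃ i, v = diagonalNeighbor u i := by
  have : Fact (1 < 2 * N) := ⟨by omega⟩
  constructor
  · rintro ⟨-, h1, h2⟩
    have key : ∀ x y : ZMod (2 * N), (y = x + 1 ∨ y = x - 1) → ∃ s, y = x + boolSign N s := by
      rintro x y (rfl | rfl)
      · exact ⟨true, rfl⟩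
      · exact ⟨false, sub_eq_add_neg x 1⟩
    obtain ⟨s, hs⟩ := key _ _ h1
    obtain ⟨t, ht⟩ := key _ _ h2
    exact ⟨(s, t), Prod.ext hs ht⟩
  · rintro ⟨⟨s, t⟩, rfl⟩
    refine ⟨?_, ?_, ?_⟩
    · intro h
      have h1 := congrArg Prod.fst h
      cases s <;> simp [diagonalNeighbor, boolSign] at h1
    · cases s <;> simp [diagonalNeighbor, boolSign, sub_eq_add_neg]
    · cases t <;> simp [diagonalNeighbor, boolSign, sub_eq_add_neg]

open Classical in
/-- The boolean value of a relation. -/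
def relBit (R : Torus N → Torus N → Prop) (u v : Torus N) : Bool := decide (R u v)

theorem relBit_eq_true {R : Torus N → Torus N → Prop} {u v : Torus N} :
    relBit R u v = true ↔ R u v := by
  simp [relBit]

/-- The number of neighbours related to `u`. -/
def pairingDegree (R : Torus N → Torus N → Prop) (u : Torus N) : ℕ :=
  ∑ i : Bool × Bool, (relBit R u (diagonalNeighbor u i)).toNat

/-- Unique existence becomes an equation between natural numbers, the form used for cell matchings;
the four neighbours are distinct because `2 ≤ N`. -/
theorem pairingDegree_eq_one_iff (hN : 2 ≤ N) {R : Torus N → Torus N → Prop}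
    (hR : ∀ u v, R u v → (cornerGraph N N).Adj u v) (u : Torus N) :
    pairingDegree R u = 1 ↔ ∃! v, R u v := by
  classical
  have h1 : pairingDegree R u =
      Fintype.card {i : Bool × Bool // R u (diagonalNeighbor u i)} := by
    rw [Fintype.card_subtype, Finset.card_filter, pairingDegree]
    refine Finset.sum_congr rfl fun i _ => ?_
    by_cases h : R u (diagonalNeighbor u i) <;> simp [relBit, h]
  rw [h1, Fintype.card_eq_one_iff]
  constructor
  · rintro ⟨⟨i, hi⟩, huniq⟩
    refine ⟨_, hi, fun v hv => ?_⟩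
    obtain ⟨j, rfl⟩ := (cornerGraph_adj_iff hN u v).1 (hR u v hv)
    rw [show j = i from congrArg Subtype.val (huniq ⟨j, hv⟩)]
  · rintro ⟨v, hv, huniq⟩
    obtain ⟨i, rfl⟩ := (cornerGraph_adj_iff hN u v).1 (hR u v hv)
    refine ⟨⟨i, hv⟩, fun j => Subtype.ext ?_⟩
    exact diagonalNeighbor_injective hN u (huniq _ j.2)

theorem pairingDegree_eq_zero_iff (hN : 2 ≤ N) {R : Torus N → Torus N → Prop}
    (hR : ∀ u v, R u v → (cornerGraph N N).Adj u v) (u : Torus N) :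
    pairingDegree R u = 0 ↔ ∀ v, ¬ R u v := by
  classical
  rw [pairingDegree, Finset.sum_eq_zero_iff]
  constructor
  · intro h v hv
    obtain ⟨i, rfl⟩ := (cornerGraph_adj_iff hN u v).1 (hR u v hv)
    have := h i (Finset.mem_univ i)
    simp [relBit, hv] at this
  · intro h i _
    simp [relBit, h]

theorem par_boolSign (s : Bool) : par N (boolSign N s) = 1 := by
  cases s
  · simp only [boolSign_false, map_neg, map_one]
    rfl
  · simp [boolSign_true]

theorem vertical_ne_horizontal {ε : ZMod 2} (c d : Cell N ε) (a b : Bool) :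
    vertical c a ≠ horizontal d b := by
  intro h
  have h1 := congrArg (fun z : Torus N => par N z.1) h
  simp only [vertical, horizontal, map_add, c.2.1, d.2.1] at h1
  rw [par_boolSign] at h1
  simp at h1

theorem vertical_mem {ε : ZMod 2} (c : Cell N ε) (a : Bool) :
    vertical c a ∈ toTorus N N '' gridVertices := by
  rw [mem_image_gridVertices]
  simp only [vertical, map_add, c.2.1, c.2.2, par_boolSign, ← add_assoc, CharTwo.add_self_eq_zero,
    zero_add]

theorem horizontal_mem {ε : ZMod 2} (c : Cell N ε) (a : Bool) :
    horizontal c a ∈ toTorus N N '' gridVertices := by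
  rw [mem_image_gridVertices]
  simp only [horizontal, map_add, c.2.1, c.2.2, par_boolSign, add_right_comm,
    CharTwo.add_self_eq_zero, zero_add]

/-- Exactly one coordinate of a grid vertex has parity `ε`. If it is the first, the cell below has
the vertex to its north; if the second, the cell to the left has it to its east. -/
theorem eq_vertical_or_eq_horizontal (ε : ZMod 2) {u : Torus N}
    (hu : u ∈ toTorus N N '' gridVertices) :
    (∃ c : Cell N ε, u = vertical c true) ∨ (∃ c : Cell N ε, u = horizontal c true) := by
  rw [mem_image_gridVertices] at hu
  have key : ∀ x y e : ZMod 2, x + y = 1 → (x = e ∧ y - 1 = e) ∨ (x - 1 = e ∧ y = e) := by decide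
  rcases key _ _ ε hu with h | h
  · left
    refine ⟨⟨(u.1, u.2 - 1), h.1, by rw [map_sub, map_one]; exact h.2⟩, ?_⟩
    simp [vertical, boolSign_true]
  · right
    refine ⟨⟨(u.1 - 1, u.2), by rw [map_sub, map_one]; exact h.1, h.2⟩, ?_⟩
    simp [horizontal, boolSign_true]

theorem vertical_cellUp {ε : ZMod 2} (c : Cell N ε) :
    vertical (cellUp N ε c) false = vertical c true := by
  simp only [vertical, cellUp, Equiv.coe_fn_mk, boolSign_true, boolSign_false]
  ext <;> ring

theorem horizontal_cellRight {ε : ZMod 2} (c : Cell N ε) :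
    horizontal (cellRight N ε c) false = horizontal c true := by
  simp only [horizontal, cellRight, Equiv.coe_fn_mk, boolSign_true, boolSign_false]
  ext <;> ring

/-- An edge going down from a north vertex lies in the same cell, one going up in the cell above. -/
theorem exists_cell_of_adj (hN : 2 ≤ N) {ε : ZMod 2} (c : Cell N ε) {v : Torus N}
    (h : (cornerGraph N N).Adj (vertical c true) v) :
    ∃ (d : Cell N ε) (a b : Bool), vertical c true = vertical d a ∧ v = horizontal d b := by
  obtain ⟨⟨s, t⟩, rfl⟩ := (cornerGraph_adj_iff hN _ _).1 h
  cases t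
  · refine ⟨c, true, s, rfl, ?_⟩
    simp [diagonalNeighbor, vertical, horizontal, boolSign_true, boolSign_false]
  · refine ⟨cellUp N ε c, false, s, (vertical_cellUp c).symm, ?_⟩
    simp only [diagonalNeighbor, vertical, horizontal, boolSign_true, cellUp, Equiv.coe_fn_mk]
    ext <;> ring

theorem adj_vertical_horizontal (hN : 2 ≤ N) {ε : ZMod 2} (c : Cell N ε) (a b : Bool) :
    (cornerGraph N N).Adj (vertical c a) (horizontal c b) := by
  rw [cornerGraph_adj_iff hN]
  refine ⟨(b, !a), ?_⟩
  cases a <;> simp [diagonalNeighbor, vertical, horizontal, boolSign]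

/-- A north or south vertex fixes the first coordinate of the centre, an east or west one the
second; hence an edge lies in only one cell of a class. -/
theorem cell_ext_of_vertical_horizontal (hN : 2 ≤ N) {ε : ZMod 2} {c d : Cell N ε}
    {a a' b b' : Bool} (h1 : vertical c a = vertical d a') (h2 : horizontal c b = horizontal d b') :
    c = d ∧ a = a' ∧ b = b' := by
  simp only [vertical, horizontal, Prod.mk.injEq] at h1 h2
  have hc : c = d := Subtype.ext (Prod.ext h1.1 h2.2)
  subst hc
  refine ⟨rfl, boolSign_injective hN ?_, boolSign_injective hN ?_⟩
  · simpa using h1.2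
  · simpa using h2.1

/-- The edges selected in each cell by a relation. -/
def cellEdges {ε : ZMod 2} (R : Torus N → Torus N → Prop) (c : Cell N ε) (a b : Bool) : Bool :=
  relBit R (vertical c a) (horizontal c b)

theorem rowSum_cellEdges {ε : ZMod 2} (R : Torus N → Torus N → Prop) (c : Cell N ε) :
    rowSum (cellEdges R c) true + rowSum (cellEdges R (cellUp N ε c)) false =
      pairingDegree R (vertical c true) := by
  have h1 : ∀ b, horizontal c b = diagonalNeighbor (vertical c true) (b, false) := by
    intro b
    simp [diagonalNeighbor, vertical, horizontal, boolSign_true, boolSign_false]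
  have h2 : ∀ b, horizontal (cellUp N ε c) b = diagonalNeighbor (vertical c true) (b, true) := by
    intro b
    simp only [diagonalNeighbor, vertical, horizontal, boolSign_true, cellUp, Equiv.coe_fn_mk]
    ext <;> ring
  simp only [rowSum, cellEdges, vertical_cellUp, h1, h2, pairingDegree, Fintype.sum_prod_type,
    Fintype.sum_bool]
  omega

theorem colSum_cellEdges {ε : ZMod 2} {R : Torus N → Torus N → Prop}
    (hR : ∀ u v, R u v → R v u) (c : Cell N ε) :
    colSum (cellEdges R c) true + colSum (cellEdges R (cellRight N ε c)) false =
      pairingDegree R (horizontal c true) := by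
  have hR' : ∀ u v, relBit R u v = relBit R v u := fun u v => by
    rw [Bool.eq_iff_iff, relBit_eq_true, relBit_eq_true]
    exact ⟨hR u v, hR v u⟩
  have h1 : ∀ b, vertical c b = diagonalNeighbor (horizontal c true) (false, b) := by
    intro b
    simp [diagonalNeighbor, vertical, horizontal, boolSign_true, boolSign_false]
  have h2 : ∀ b, vertical (cellRight N ε c) b =
      diagonalNeighbor (horizontal c true) (true, b) := by
    intro b
    simp only [diagonalNeighbor, vertical, horizontal, boolSign_true, cellRight, Equiv.coe_fn_mk]
    ext <;> ring
  simp only [colSum, cellEdges, horizontal_cellRight, h1, h2, pairingDegree,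
    Fintype.sum_prod_type, Fintype.sum_bool]
  simp only [hR' _ (horizontal c true)]
  omega

open Classical in
theorem pairingDegree_eq_ite (hN : 2 ≤ N) {S Q : Set (Torus N)} {R : Torus N → Torus N → Prop}
    (hR : IsPairing (cornerGraph N N) (S \ Q) R) {u : Torus N} (hu : u ∈ S) :
    pairingDegree R u = if u ∈ Q then 0 else 1 := by
  split_ifs with h
  · rw [pairingDegree_eq_zero_iff hN hR.adj]
    intro v hv
    exact (hR.mem u v hv).2 h
  · rw [pairingDegree_eq_one_iff hN hR.adj]
    exact hR.existsUnique u ⟨hu, h⟩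

theorem cellEdges_isCellMatching (hN : 2 ≤ N) (ε : ZMod 2) {Q : Set (Torus N)}
    {R : Torus N → Torus N → Prop}
    (hR : IsPairing (cornerGraph N N) (toTorus N N '' gridVertices \ Q) R) :
    IsCellMatching (cellUp N ε) (cellRight N ε) (fun c => vertical c true ∈ Q)
      (fun c => horizontal c true ∈ Q) (cellEdges R) := by
  intro c
  rw [rowSum_cellEdges, colSum_cellEdges hR.symm,
    pairingDegree_eq_ite hN hR (vertical_mem c true),
    pairingDegree_eq_ite hN hR (horizontal_mem c true)]
  exact ⟨rfl, rfl⟩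

theorem eq_of_cellEdges_eq (hN : 2 ≤ N) (ε : ZMod 2) {S Q : Set (Torus N)}
    (hS : S = toTorus N N '' gridVertices) {R R' : Torus N → Torus N → Prop}
    (hR : IsPairing (cornerGraph N N) (S \ Q) R) (hR' : IsPairing (cornerGraph N N) (S \ Q) R')
    (h : (cellEdges R : Cell N ε → Bool → Bool → Bool) = cellEdges R') : R = R' := by
  have aux : ∀ {R R' : Torus N → Torus N → Prop}, IsPairing (cornerGraph N N) (S \ Q) R →
      IsPairing (cornerGraph N N) (S \ Q) R' →
      ((cellEdges R : Cell N ε → Bool → Bool → Bool) = cellEdges R') →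
      ∀ u v, R u v → R' u v := by
    intro R R' hR hR' h
    have h' : ∀ (c : Cell N ε) a b, R (vertical c a) (horizontal c b) ↔
        R' (vertical c a) (horizontal c b) := by
      intro c a b
      have := congrFun (congrFun (congrFun h c) a) b
      simpa [cellEdges, relBit] using this
    have key : ∀ (c : Cell N ε) v, R (vertical c true) v → R' (vertical c true) v := by
      intro c v hv
      obtain ⟨d, a, b, h1, rfl⟩ := exists_cell_of_adj hN c (hR.adj _ _ hv)
      rw [h1] at hv ⊢
      exact (h' d a b).1 hv
    intro u v huv
    have hu := (hR.mem u v huv).1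
    have hv := (hR.mem v u (hR.symm u v huv)).1
    rw [hS] at hu hv
    rcases eq_vertical_or_eq_horizontal ε hu with ⟨c, rfl⟩ | ⟨c, rfl⟩
    · exact key c v huv
    · rcases eq_vertical_or_eq_horizontal ε hv with ⟨d, rfl⟩ | ⟨d, rfl⟩
      · exact hR'.symm _ _ (key d _ (hR.symm _ _ huv))
      · exfalso
        have hadj := hR.adj _ _ huv
        obtain ⟨i, hi⟩ := (cornerGraph_adj_iff hN _ _).1 hadj
        have h1 := congrArg (fun z : Torus N => par N z.2) hi
        simp [diagonalNeighbor, horizontal, c.2.2, d.2.2, par_boolSign] at h1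
  funext u v
  exact propext ⟨aux hR hR' h u v, aux hR' hR h.symm u v⟩

/-- The relation defined by a selection of edges in each cell. -/
def pairingOfEdges {ε : ZMod 2} (m : Cell N ε → Bool → Bool → Bool) (u v : Torus N) : Prop :=
  ∃ c a b, m c a b = true ∧
    ((u = vertical c a ∧ v = horizontal c b) ∨ (v = vertical c a ∧ u = horizontal c b))

theorem cellEdges_pairingOfEdges (hN : 2 ≤ N) {ε : ZMod 2} (m : Cell N ε → Bool → Bool → Bool) :
    cellEdges (pairingOfEdges m) = m := by
  funext c a b
  rw [Bool.eq_iff_iff]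
  rw [cellEdges, relBit_eq_true]
  constructor
  · rintro ⟨d, a', b', hm, ⟨h1, h2⟩ | ⟨h1, -⟩⟩
    · obtain ⟨rfl, rfl, rfl⟩ := cell_ext_of_vertical_horizontal hN h1 h2
      exact hm
    · exact absurd h1.symm (vertical_ne_horizontal _ _ _ _)
  · intro h
    exact ⟨c, a, b, h, Or.inl ⟨rfl, rfl⟩⟩

theorem pairingOfEdges_isPairing (hN : 2 ≤ N) {ε : ZMod 2} {Q : Set (Torus N)}
    {m : Cell N ε → Bool → Bool → Bool}
    (hm : IsCellMatching (cellUp N ε) (cellRight N ε) (fun c => vertical c true ∈ Q)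
      (fun c => horizontal c true ∈ Q) m) :
    IsPairing (cornerGraph N N) (toTorus N N '' gridVertices \ Q) (pairingOfEdges m) := by
  have hsymm : ∀ u v, pairingOfEdges m u v → pairingOfEdges m v u := by
    rintro u v ⟨c, a, b, h, h'⟩
    exact ⟨c, a, b, h, h'.symm⟩
  have hadj : ∀ u v, pairingOfEdges m u v → (cornerGraph N N).Adj u v := by
    rintro u v ⟨c, a, b, h, ⟨rfl, rfl⟩ | ⟨rfl, rfl⟩⟩
    · exact adj_vertical_horizontal hN c a b
    · exact (adj_vertical_horizontal hN c a b).symm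
  classical
  have hdeg : ∀ u ∈ toTorus N N '' gridVertices,
      pairingDegree (pairingOfEdges m) u = if u ∈ Q then 0 else 1 := by
    intro u hu
    rcases eq_vertical_or_eq_horizontal ε hu with ⟨c, rfl⟩ | ⟨c, rfl⟩
    · rw [← rowSum_cellEdges, cellEdges_pairingOfEdges hN]
      convert (hm c).1
    · rw [← colSum_cellEdges hsymm, cellEdges_pairingOfEdges hN]
      convert (hm c).2
  refine ⟨hsymm, hadj, fun u v huv => ?_, fun u hu => ?_⟩
  · have hu : u ∈ toTorus N N '' gridVertices := by
      obtain ⟨c, a, b, -, ⟨rfl, -⟩ | ⟨-, rfl⟩⟩ := huv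
      · exact vertical_mem c a
      · exact horizontal_mem c b
    refine ⟨hu, fun hQ => ?_⟩
    have h := hdeg u hu
    rw [if_pos hQ, pairingDegree_eq_zero_iff hN hadj] at h
    exact h v huv
  · rw [← pairingDegree_eq_one_iff hN hadj, hdeg u hu.1, if_neg hu.2]

theorem numPerfectMatchings_eq_cellPartition (hN : 2 ≤ N) (ε : ZMod 2) (Q : Set (Torus N)) :
    numPerfectMatchings ((cornerGraph N N).induce (toTorus N N '' gridVertices \ Q)) =
      cellPartition (cellUp N ε) (cellRight N ε) (fun c => vertical c true ∈ Q)
        (fun c => horizontal c true ∈ Q) := by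
  rw [numPerfectMatchings_induce, cellPartition]
  refine Nat.card_congr
    { toFun := fun R => ⟨cellEdges R.1, cellEdges_isCellMatching hN ε R.2⟩
      invFun := fun m => ⟨pairingOfEdges m.1, pairingOfEdges_isPairing hN m.2⟩
      left_inv := ?_
      right_inv := ?_ }
  · intro R
    refine Subtype.ext (eq_of_cellEdges_eq hN ε rfl (pairingOfEdges_isPairing hN
      (cellEdges_isCellMatching hN ε R.2)) R.2 ?_)
    exact cellEdges_pairingOfEdges hN _
  · intro m
    exact Subtype.ext (cellEdges_pairingOfEdges hN _)

end Torus

/-! ### Complementation in the plane -/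

section Plane

/-- The torus of side `2N` sees the points of the plane within distance `r` of the origin, and
their neighbours, faithfully. -/
theorem toTorus_eq_iff {N : ℕ} {r : ℤ} (hr : r + 4 ≤ N) {p q : ℤ × ℤ}
    (hp : |p.1| ≤ N + 2 ∧ |p.2| ≤ N + 2) (hq : |q.1| ≤ r ∧ |q.2| ≤ r) :
    toTorus N N p = toTorus N N q ↔ p = q := by
  constructor
  · intro h
    have key : ∀ a b : ℤ, |a| ≤ N + 2 → |b| ≤ r →
        ((a : ZMod (2 * N)) = (b : ZMod (2 * N))) → a = b := by
      intro a b ha hb hab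
      rw [ZMod.intCast_eq_intCast_iff_dvd_sub] at hab
      -- The difference is at most (N + 2) + (N - 4) in absolute value, less than the period 2N.
      have h0 : b - a = 0 := by
        refine Int.eq_zero_of_abs_lt_dvd hab ?_
        rw [abs_le] at ha hb
        rw [abs_lt]
        push_cast
        constructor <;> omega
      omega
    exact Prod.ext (key _ _ hp.1 hq.1 (congrArg Prod.fst h))
      (key _ _ hp.2 hq.2 (congrArg Prod.snd h))
  · rintro rfl
    rfl

theorem toTorus_mem_image_iff {N : ℕ} {r : ℤ} (hr : r + 4 ≤ N) {S : Set (ℤ × ℤ)}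
    (hS : ∀ p ∈ S, |p.1| ≤ r ∧ |p.2| ≤ r) {p : ℤ × ℤ} (hp : |p.1| ≤ N + 2 ∧ |p.2| ≤ N + 2) :
    toTorus N N p ∈ toTorus N N '' S ↔ p ∈ S := by
  constructor
  · rintro ⟨q, hq, h⟩
    rw [(toTorus_eq_iff hr hp (hS q hq)).1 h.symm]
    exact hq
  · intro h
    exact ⟨p, h, rfl⟩

theorem toTorus_injOn {N : ℕ} {r : ℤ} (hr : r + 4 ≤ N) {S : Set (ℤ × ℤ)}
    (hS : ∀ p ∈ S, |p.1| ≤ r ∧ |p.2| ≤ r) : Set.InjOn (toTorus N N) S := by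
  intro p hp q hq h
  have hp' := hS p hp
  exact (toTorus_eq_iff hr ⟨by omega, by omega⟩ (hS q hq)).1 h

theorem exists_bounded_toTorus {N : ℕ} (hN : 0 < N) (z : Torus N) :
    ∃ p, toTorus N N p = z ∧ |p.1| ≤ N ∧ |p.2| ≤ N := by
  have key : ∀ x : ZMod (2 * N), ∃ a : ℤ, (a : ZMod (2 * N)) = x ∧ |a| ≤ N := by
    intro x
    obtain ⟨a, rfl⟩ := ZMod.intCast_surjective x
    refine ⟨(a + N) % (2 * N : ℕ) - N, ?_, ?_⟩
    · push_cast [ZMod.intCast_mod]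
      have : (((a + N) % (2 * N : ℕ) : ℤ) : ZMod (2 * N)) = ((a + N : ℤ) : ZMod (2 * N)) :=
        ZMod.intCast_mod _ _
      push_cast at this
      rw [this]
      ring
    · have h1 := Int.emod_nonneg (a + N) (b := ((2 * N : ℕ) : ℤ)) (by omega)
      have h2 := Int.emod_lt_of_pos (a + N) (b := ((2 * N : ℕ) : ℤ)) (by omega)
      rw [abs_le]
      constructor <;> omega
  obtain ⟨a, ha, ha'⟩ := key z.1
  obtain ⟨b, hb, hb'⟩ := key z.2
  exact ⟨(a, b), Prod.ext ha hb, ha', hb'⟩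

/-- The sets of vertices `H` and `H'` are complementary with respect to the cells centred at the
points of `D`, all of whose coordinates have the parity of `e`. -/
structure PlaneComplementary (e : ℤ) (D H H' : Set (ℤ × ℤ)) : Prop where
  parity : ∀ p ∈ D, p.1 % 2 = e ∧ p.2 % 2 = e
  or_north : ∀ x y : ℤ, x % 2 = e → y % 2 = e →
    ((x, y + 1) ∈ H ∨ (x, y + 1) ∈ H' ↔ (x, y) ∈ D ∨ (x, y + 2) ∈ D)
  and_north : ∀ x y : ℤ, x % 2 = e → y % 2 = e →
    ((x, y + 1) ∈ H ∧ (x, y + 1) ∈ H' ↔ (x, y) ∈ D ∧ (x, y + 2) ∈ D)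
  or_east : ∀ x y : ℤ, x % 2 = e → y % 2 = e →
    ((x + 1, y) ∈ H ∨ (x + 1, y) ∈ H' ↔ (x, y) ∈ D ∨ (x + 2, y) ∈ D)
  and_east : ∀ x y : ℤ, x % 2 = e → y % 2 = e →
    ((x + 1, y) ∈ H ∧ (x + 1, y) ∈ H' ↔ (x, y) ∈ D ∧ (x + 2, y) ∈ D)
  mem : ∀ x y : ℤ, (x, y) ∈ D →
    (((x, y + 1) ∈ H ∧ (x, y - 1) ∈ H) ∧ ((x + 1, y) ∈ H' ∧ (x - 1, y) ∈ H')) ∨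
    (((x, y + 1) ∈ H' ∧ (x, y - 1) ∈ H') ∧ ((x + 1, y) ∈ H ∧ (x - 1, y) ∈ H))

theorem or_union_iff {a a' b b' d d' f f' : Prop} (h : a ∨ a' ↔ d ∨ d') (h' : b ∨ b' ↔ f ∨ f') :
    (a ∨ b) ∨ (a' ∨ b') ↔ (d ∨ f) ∨ (d' ∨ f') := by
  rw [or_or_or_comm, h, h', or_or_or_comm]

theorem and_union_iff {a a' b b' d d' f f' : Prop} (h : a ∨ a' ↔ d ∨ d') (h' : b ∨ b' ↔ f ∨ f')
    (k : a ∧ a' ↔ d ∧ d') (k' : b ∧ b' ↔ f ∧ f') (hd : a ∨ a' → b ∨ b' → False) :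
    (a ∨ b) ∧ (a' ∨ b') ↔ (d ∨ f) ∧ (d' ∨ f') := by
  by_cases ha : a ∨ a'
  · have hb : ¬ (b ∨ b') := hd ha
    have hf := hb
    rw [h'] at hf
    rw [not_or] at hb hf
    simp only [hb, hf, or_false]
    exact k
  · have hf := ha
    rw [h] at hf
    rw [not_or] at ha hf
    simp only [ha, hf, false_or]
    exact k'

/-- Disjointness serves the `and` fields: it excludes vertices common to `H` and `K'` and vertices
shared by a cell of `D` and a cell of `E`. -/
theorem PlaneComplementary.union {e : ℤ} {D H H' E K K' : Set (ℤ × ℤ)}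
    (h : PlaneComplementary e D H H') (h' : PlaneComplementary e E K K')
    (hd : Disjoint (H ∪ H') (K ∪ K')) : PlaneComplementary e (D ∪ E) (H ∪ K) (H' ∪ K') := by
  have hd' : ∀ p, (p ∈ H ∨ p ∈ H') → (p ∈ K ∨ p ∈ K') → False := fun p h1 h2 =>
    Set.disjoint_left.1 hd h1 h2
  refine ⟨?_, ?_, ?_, ?_, ?_, ?_⟩
  · rintro p (hp | hp)
    · exact h.parity p hp
    · exact h'.parity p hp
  · intro x y hx hy
    exact or_union_iff (h.or_north x y hx hy) (h'.or_north x y hx hy)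
  · intro x y hx hy
    exact and_union_iff (h.or_north x y hx hy) (h'.or_north x y hx hy) (h.and_north x y hx hy)
      (h'.and_north x y hx hy) (hd' _)
  · intro x y hx hy
    exact or_union_iff (h.or_east x y hx hy) (h'.or_east x y hx hy)
  · intro x y hx hy
    exact and_union_iff (h.or_east x y hx hy) (h'.or_east x y hx hy) (h.and_east x y hx hy)
      (h'.and_east x y hx hy) (hd' _)
  · rintro x y (hp | hp)
    · rcases h.mem x y hp with ⟨⟨h1, h2⟩, h3, h4⟩ | ⟨⟨h1, h2⟩, h3, h4⟩
      · exact Or.inl ⟨⟨Or.inl h1, Or.inl h2⟩, Or.inl h3, Or.inl h4⟩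
      · exact Or.inr ⟨⟨Or.inl h1, Or.inl h2⟩, Or.inl h3, Or.inl h4⟩
    · rcases h'.mem x y hp with ⟨⟨h1, h2⟩, h3, h4⟩ | ⟨⟨h1, h2⟩, h3, h4⟩
      · exact Or.inl ⟨⟨Or.inr h1, Or.inr h2⟩, Or.inr h3, Or.inr h4⟩
      · exact Or.inr ⟨⟨Or.inr h1, Or.inr h2⟩, Or.inr h3, Or.inr h4⟩

theorem par_intCast_eq_iff {N : ℕ} {e : ℤ} (he : e = 0 ∨ e = 1) (a : ℤ) :
    par N (a : ZMod (2 * N)) = (e : ZMod 2) ↔ a % 2 = e := by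
  rw [par_intCast, intCast_zmod_two_eq_iff]
  omega

/-- A cell, represented by a point of the plane near the origin. -/
theorem Cell.exists_lift {N : ℕ} (hN : 0 < N) {e : ℤ} (he : e = 0 ∨ e = 1)
    (c : Cell N (e : ZMod 2)) :
    ∃ x y : ℤ, x % 2 = e ∧ y % 2 = e ∧ |x| ≤ N ∧ |y| ≤ N ∧ c.1 = toTorus N N (x, y) := by
  obtain ⟨⟨x, y⟩, h, hx, hy⟩ := exists_bounded_toTorus hN c.1
  refine ⟨x, y, ?_, ?_, hx, hy, h.symm⟩
  · rw [← par_intCast_eq_iff he (N := N), ← c.2.1, ← h]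
    rfl
  · rw [← par_intCast_eq_iff he (N := N), ← c.2.2, ← h]
    rfl

/-- Each cell is lifted to a centre with coordinates at most `N` in absolute value. Its vertices and
the neighbouring centres stay within `N + 2`, where membership on the torus is membership in the
plane. -/
theorem PlaneComplementary.complementary {e : ℤ} (he : e = 0 ∨ e = 1) {D H H' : Set (ℤ × ℤ)}
    (h : PlaneComplementary e D H H') {N : ℕ} {r : ℤ} (hN : 0 < N) (hr : r + 4 ≤ N)
    (hb : ∀ p ∈ D ∪ (H ∪ H'), |p.1| ≤ r ∧ |p.2| ≤ r) :
    Complementary (cellUp N e) (cellRight N e) (fun c => c.1 ∈ toTorus N N '' D)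
      (fun c => vertical c true ∈ toTorus N N '' H)
      (fun c => horizontal c true ∈ toTorus N N '' H)
      (fun c => vertical c true ∈ toTorus N N '' H')
      (fun c => horizontal c true ∈ toTorus N N '' H') := by
  have hD : ∀ p : ℤ × ℤ, |p.1| ≤ N + 2 ∧ |p.2| ≤ N + 2 →
      (toTorus N N p ∈ toTorus N N '' D ↔ p ∈ D) := fun p hp =>
    toTorus_mem_image_iff hr (fun q hq => hb q (Or.inl hq)) hp
  have hH : ∀ p : ℤ × ℤ, |p.1| ≤ N + 2 ∧ |p.2| ≤ N + 2 →
      (toTorus N N p ∈ toTorus N N '' H ↔ p ∈ H) := fun p hp =>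
    toTorus_mem_image_iff hr (fun q hq => hb q (Or.inr (Or.inl hq))) hp
  have hH' : ∀ p : ℤ × ℤ, |p.1| ≤ N + 2 ∧ |p.2| ≤ N + 2 →
      (toTorus N N p ∈ toTorus N N '' H' ↔ p ∈ H') := fun p hp =>
    toTorus_mem_image_iff hr (fun q hq => hb q (Or.inr (Or.inr hq))) hp
  have cast_c : ∀ (c : Cell N (e : ZMod 2)) (x y : ℤ), c.1 = toTorus N N (x, y) →
      vertical c true = toTorus N N (x, y + 1) ∧ horizontal c true = toTorus N N (x + 1, y) ∧
      vertical ((cellUp N e).symm c) true = toTorus N N (x, y - 1) ∧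
      horizontal ((cellRight N e).symm c) true = toTorus N N (x - 1, y) ∧
      (cellUp N e c).1 = toTorus N N (x, y + 2) ∧
      (cellRight N e c).1 = toTorus N N (x + 2, y) := by
    intro c x y hc
    refine ⟨?_, ?_, ?_, ?_, ?_, ?_⟩ <;>
      ext <;> simp [vertical, horizontal, cellUp, cellRight, boolSign_true, toTorus, hc] <;> ring
  refine ⟨fun c => ?_, fun c => ?_, fun c => ?_, fun c => ?_, fun c => ?_⟩ <;>
    obtain ⟨x, y, hx, hy, hx', hy', hc⟩ := c.exists_lift hN he <;>
    obtain ⟨h1, h2, h3, h4, h5, h6⟩ := cast_c c x y hc <;>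
    rw [abs_le] at hx' hy'
  · rw [h1, h5, hc, hD, hD, hH, hH']
    · exact h.or_north x y hx hy
    all_goals constructor <;> rw [abs_le] <;> constructor <;> dsimp only <;> omega
  · rw [h1, h5, hc, hD, hD, hH, hH']
    · exact h.and_north x y hx hy
    all_goals constructor <;> rw [abs_le] <;> constructor <;> dsimp only <;> omega
  · rw [h2, h6, hc, hD, hD, hH, hH']
    · exact h.or_east x y hx hy
    all_goals constructor <;> rw [abs_le] <;> constructor <;> dsimp only <;> omega
  · rw [h2, h6, hc, hD, hD, hH, hH']
    · exact h.and_east x y hx hy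
    all_goals constructor <;> rw [abs_le] <;> constructor <;> dsimp only <;> omega
  · rw [h1, h2, h3, h4, hc, hD, hH, hH, hH, hH, hH', hH', hH', hH']
    · exact h.mem x y
    all_goals constructor <;> rw [abs_le] <;> constructor <;> dsimp only <;> omega

open Classical in
theorem card_cell_filter_center {N : ℕ} [NeZero (2 * N)] {e : ℤ} (he : e = 0 ∨ e = 1)
    {D : Set (ℤ × ℤ)} (hD : ∀ p ∈ D, p.1 % 2 = e ∧ p.2 % 2 = e) {r : ℤ} (hr : r + 4 ≤ N)
    (hb : ∀ p ∈ D, |p.1| ≤ r ∧ |p.2| ≤ r) :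
    (Finset.univ.filter fun c : Cell N (e : ZMod 2) => c.1 ∈ toTorus N N '' D).card = D.ncard := by
  rw [← (toTorus_injOn hr hb).ncard_image, ← Set.ncard_coe_finset,
    ← Set.ncard_image_of_injective _ (Subtype.val_injective (p := fun z : Torus N =>
      par N z.1 = (e : ZMod 2) ∧ par N z.2 = (e : ZMod 2)))]
  congr 1
  ext z
  constructor
  · rintro ⟨c, hc, rfl⟩
    simpa using hc
  · rintro ⟨p, hp, rfl⟩
    refine ⟨⟨toTorus N N p, ?_, ?_⟩, ?_, rfl⟩
    · exact (par_intCast_eq_iff he _).2 (hD p hp).1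
    · exact (par_intCast_eq_iff he _).2 (hD p hp).2
    · simpa using ⟨_, _, hp, rfl⟩

open Classical in
theorem card_cell_filter_north {N : ℕ} [NeZero (2 * N)] {e : ℤ} (he : e = 0 ∨ e = 1)
    {H : Set (ℤ × ℤ)} (hH : H ⊆ gridVertices) {r : ℤ} (hr : r + 4 ≤ N)
    (hb : ∀ p ∈ H, |p.1| ≤ r ∧ |p.2| ≤ r) :
    (Finset.univ.filter fun c : Cell N (e : ZMod 2) =>
      vertical c true ∈ toTorus N N '' H).card = (H ∩ {p | p.1 % 2 = e}).ncard := by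
  have hinj : Function.Injective fun c : Cell N (e : ZMod 2) => vertical c true := by
    intro c d h
    simp only [vertical, Prod.mk.injEq, add_left_inj] at h
    exact Subtype.ext (Prod.ext h.1 h.2)
  rw [← (toTorus_injOn hr fun p hp => hb p hp.1).ncard_image, ← Set.ncard_coe_finset,
    ← Set.ncard_image_of_injective _ hinj]
  congr 1
  ext z
  constructor
  · rintro ⟨c, hc, rfl⟩
    simp only [Finset.coe_filter, Finset.mem_univ, true_and, Set.mem_ofPred_eq] at hc
    obtain ⟨p, hp, hpc⟩ := hc
    refine ⟨p, ⟨hp, ?_⟩, hpc⟩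
    have h1 := congrArg (fun z : Torus N => par N z.1) hpc
    simp only [vertical, c.2.1] at h1
    exact (par_intCast_eq_iff he _).1 h1
  · rintro ⟨p, ⟨hp, hpe⟩, rfl⟩
    have hpg := Int.odd_iff.1 (hH hp)
    have hpe' : p.1 % 2 = e := hpe
    refine ⟨⟨toTorus N N (p.1, p.2 - 1), ?_, ?_⟩, ?_, ?_⟩
    · exact (par_intCast_eq_iff he _).2 hpe
    · exact (par_intCast_eq_iff he _).2 (by dsimp only; omega)
    · simp only [Finset.coe_filter, Finset.mem_univ, true_and, Set.mem_ofPred_eq]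
      refine ⟨p, hp, ?_⟩
      simp [vertical, toTorus, boolSign_true]
    · simp [vertical, toTorus, boolSign_true]

/-- This replaces exponents that count what remains, and grow with the torus, by exponents that
count what is removed; later it cancels the common part of two exponents. -/
theorem mul_pow_eq_of_add_eq {M M' d d' x x' : ℕ} (h : M' * 2 ^ x' = 2 ^ d' * M)
    (hd : d + d' = x + x') : M' * 2 ^ d = 2 ^ x * M := by
  have h1 : 2 ^ (d' + x') ≠ 0 := by positivity
  refine Nat.eq_of_mul_eq_mul_right (Nat.pos_of_ne_zero h1) ?_
  calc M' * 2 ^ d * 2 ^ (d' + x') = (M' * 2 ^ x') * 2 ^ (d + d') := by ring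
    _ = 2 ^ x * M * 2 ^ (d' + x') := by rw [h, hd]; ring

/-- Complementation for the numbers of perfect matchings of large tori with holes. -/
theorem PlaneComplementary.numPerfectMatchings_mul {e : ℤ} (he : e = 0 ∨ e = 1) {D H H' : Set (ℤ × ℤ)}
    (h : PlaneComplementary e D H H') (hH : H ⊆ gridVertices) {N : ℕ} {r : ℤ} (hN : 2 ≤ N)
    (hr : r + 4 ≤ N) (hb : ∀ p ∈ D ∪ (H ∪ H'), |p.1| ≤ r ∧ |p.2| ≤ r) :
    numPerfectMatchings (torusMinus N N H') * 2 ^ D.ncard =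
      2 ^ (H ∩ {p | p.1 % 2 = e}).ncard * numPerfectMatchings (torusMinus N N H) := by
  classical
  have : NeZero (2 * N) := ⟨by omega⟩
  have h1 := cellPartition_complementary (h.complementary he (by omega) hr hb)
  rw [← numPerfectMatchings_eq_cellPartition hN, ← numPerfectMatchings_eq_cellPartition hN] at h1
  rw [← card_cell_filter_center he h.parity hr fun p hp => hb p (Or.inl hp),
    ← card_cell_filter_north he hH hr fun p hp => hb p (Or.inr (Or.inl hp))]
  have h2 := Finset.card_filter_add_card_filter_not (s := Finset.univ)
    (fun c : Cell N (e : ZMod 2) => c.1 ∈ toTorus N N '' D)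
  have h3 := Finset.card_filter_add_card_filter_not (s := Finset.univ)
    (fun c : Cell N (e : ZMod 2) => vertical c true ∈ toTorus N N '' H)
  exact mul_pow_eq_of_add_eq h1 (h2.trans h3.symm)

end Plane

/-! ### Odd rectangles -/

section Rectangles

/-- The points of the odd rectangle with lower left corner `(a, b)`. -/
def oddRect (a b : ℤ) (k l : ℕ) : Set (ℤ × ℤ) :=
  {p | a ≤ p.1 ∧ p.1 ≤ a + 2 * l ∧ b ≤ p.2 ∧ p.2 ≤ b + 2 * k ∧ Odd (p.1 + p.2)}

theorem oddRect_subset (a b : ℤ) (k l : ℕ) : oddRect a b k l ⊆ gridVertices := fun _ hp =>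
  hp.2.2.2.2

/-- A block of `i` columns and `j` rows of points at mutual distance two. -/
def block (a b : ℤ) (i j : ℕ) : Set (ℤ × ℤ) :=
  {p | a ≤ p.1 ∧ p.1 < a + 2 * i ∧ b ≤ p.2 ∧ p.2 < b + 2 * j ∧ p.1 % 2 = a % 2 ∧ p.2 % 2 = b % 2}

theorem mem_oddRect {a b : ℤ} {k l : ℕ} {x y : ℤ} : (x, y) ∈ oddRect a b k l ↔
    a ≤ x ∧ x ≤ a + 2 * l ∧ b ≤ y ∧ y ≤ b + 2 * k ∧ (x + y) % 2 = 1 := by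
  simp [oddRect, Int.odd_iff]

theorem mem_block {a b : ℤ} {i j : ℕ} {x y : ℤ} : (x, y) ∈ block a b i j ↔
    a ≤ x ∧ x < a + 2 * i ∧ b ≤ y ∧ y < b + 2 * j ∧ x % 2 = a % 2 ∧ y % 2 = b % 2 := Iff.rfl

theorem block_eq_image (a b : ℤ) (i j : ℕ) : block a b i j =
    (fun q : ℕ × ℕ => (a + 2 * q.1, b + 2 * q.2)) '' ↑(Finset.range i ×ˢ Finset.range j) := by
  ext ⟨x, y⟩
  simp only [mem_block, Set.mem_image, Finset.coe_product, Set.mem_prod, Finset.coe_range,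
    Set.mem_Iio, Prod.exists, Prod.mk.injEq]
  constructor
  · rintro ⟨h1, h2, h3, h4, h5, h6⟩
    exact ⟨((x - a) / 2).toNat, ((y - b) / 2).toNat, by omega, by omega, by omega⟩
  · rintro ⟨s, t, h, rfl, rfl⟩
    omega

theorem ncard_block (a b : ℤ) (i j : ℕ) : (block a b i j).ncard = i * j := by
  rw [block_eq_image, Set.ncard_image_of_injective, Set.ncard_coe_finset, Finset.card_product,
    Finset.card_range, Finset.card_range]
  rintro ⟨s, t⟩ ⟨s', t'⟩ h
  simp only [Prod.mk.injEq] at h ⊢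
  omega

theorem finite_block (a b : ℤ) (i j : ℕ) : (block a b i j).Finite := by
  rw [block_eq_image]
  exact Set.Finite.image _ (Finset.finite_toSet _)

theorem oddRect_inter_eq {a b e : ℤ} (k l : ℕ) (ha : a % 2 = e) (hb : (b + 1) % 2 = e) :
    oddRect a b k l ∩ {p | p.1 % 2 = e} = block a b (l + 1) (k + 1) := by
  ext ⟨x, y⟩
  rw [Set.mem_inter_iff, mem_oddRect, mem_block]
  simp only [Set.mem_ofPred_eq]
  push_cast
  omega

theorem oddRect_inter_eq' {a b e : ℤ} (k l : ℕ) (ha : (a + 1) % 2 = e) (hb : b % 2 = e) :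
    oddRect a b k l ∩ {p | p.1 % 2 = e} = block (a + 1) (b + 1) l k := by
  ext ⟨x, y⟩
  rw [Set.mem_inter_iff, mem_oddRect, mem_block]
  simp only [Set.mem_ofPred_eq]
  omega

/-- The tall hole contains all N, S vertices of the block and the E, W vertices between two of its
cells; the wide one has these roles exchanged. So their union is the set of all vertices of the
block, their intersection that of the vertices shared by two of its cells. -/
theorem planeComplementary_oddRect {a b e : ℤ} (k l : ℕ) (ha : a % 2 = e) (hb : (b + 1) % 2 = e) :
    PlaneComplementary e (block a (b + 1) (l + 1) (k + 1)) (oddRect a b (k + 1) l)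
      (oddRect (a - 1) (b + 1) k (l + 1)) := by
  refine ⟨?_, ?_, ?_, ?_, ?_, ?_⟩
  · rintro ⟨x, y⟩ h
    rw [mem_block] at h
    omega
  all_goals
    intro x y
    simp only [mem_block, mem_oddRect]
    push_cast
    omega

/-- The counterpart for a hole whose majority vertices are the E, W vertices of the same class of
cells: a wide hole becomes tall. -/
theorem planeComplementary_oddRect' {a b e : ℤ} (k l : ℕ) (ha : (a + 1) % 2 = e) (hb : b % 2 = e) :
    PlaneComplementary e (block (a + 1) b (l + 1) (k + 1)) (oddRect a b k (l + 1))
      (oddRect (a + 1) (b - 1) (k + 1) l) := by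
  refine ⟨?_, ?_, ?_, ?_, ?_, ?_⟩
  · rintro ⟨x, y⟩ h
    rw [mem_block] at h
    omega
  all_goals
    intro x y
    simp only [mem_block, mem_oddRect]
    push_cast
    omega

theorem abs_le_of_mem_oddRect {a b r : ℤ} {k l : ℕ}
    (hr : -r ≤ a ∧ a + 2 * l ≤ r ∧ -r ≤ b ∧ b + 2 * k ≤ r) :
    ∀ p ∈ oddRect a b k l, |p.1| ≤ r ∧ |p.2| ≤ r := by
  rintro ⟨x, y⟩ h
  rw [mem_oddRect] at h
  simp only [abs_le]
  omega

theorem abs_le_of_mem_block {a b r : ℤ} {i j : ℕ}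
    (hr : -r ≤ a ∧ a + 2 * i ≤ r ∧ -r ≤ b ∧ b + 2 * j ≤ r) :
    ∀ p ∈ block a b i j, |p.1| ≤ r ∧ |p.2| ≤ r := by
  rintro ⟨x, y⟩ h
  rw [mem_block] at h
  simp only [abs_le]
  omega

/-- Reshaping a pair of holes that are mirror images of each other. -/
theorem numPerfectMatchings_oddRect {a b a' b' e : ℤ} (he : e = 0 ∨ e = 1) (k l : ℕ)
    (ha : a % 2 = e) (hb : (b + 1) % 2 = e) (ha' : (a' + 1) % 2 = e) (hb' : b' % 2 = e)
    (hd : Disjoint (oddRect a b (k + 1) l ∪ oddRect (a - 1) (b + 1) k (l + 1))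
      (oddRect a' b' l (k + 1) ∪ oddRect (a' + 1) (b' - 1) (l + 1) k)) :
    ∀ᶠ N : ℕ in atTop,
      numPerfectMatchings (torusMinus N N
        (oddRect (a - 1) (b + 1) k (l + 1) ∪ oddRect (a' + 1) (b' - 1) (l + 1) k)) * 2 ^ k =
      2 ^ l * numPerfectMatchings (torusMinus N N
        (oddRect a b (k + 1) l ∪ oddRect a' b' l (k + 1))) := by
  have h := (planeComplementary_oddRect k l ha hb).union
    (planeComplementary_oddRect' l k ha' hb') hd
  obtain ⟨r, hr⟩ : ∃ r : ℕ, |a| + |b| + |a'| + |b'| + 2 * k + 2 * l + 10 ≤ (r : ℤ) :=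
    ⟨_, Int.self_le_toNat _⟩
  have bounds : ∀ x : ℤ, -|x| ≤ x ∧ x ≤ |x| ∧ 0 ≤ |x| := fun x =>
    ⟨neg_abs_le x, le_abs_self x, abs_nonneg x⟩
  have ha1 := bounds a
  have hb1 := bounds b
  have ha2 := bounds a'
  have hb2 := bounds b'
  filter_upwards [eventually_ge_atTop (r + 4)] with N hN
  have h1 := h.numPerfectMatchings_mul he
    (Set.union_subset (oddRect_subset _ _ _ _) (oddRect_subset _ _ _ _)) (N := N) (r := r)
    (by omega) (by omega) (by
      rintro p ((hp | hp) | (hp | hp) | (hp | hp))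
      · exact abs_le_of_mem_block (by push_cast; omega) p hp
      · exact abs_le_of_mem_block (by push_cast; omega) p hp
      · exact abs_le_of_mem_oddRect (by push_cast; omega) p hp
      · exact abs_le_of_mem_oddRect (by push_cast; omega) p hp
      · exact abs_le_of_mem_oddRect (by push_cast; omega) p hp
      · exact abs_le_of_mem_oddRect (by push_cast; omega) p hp)
  have hc1 : (block a (b + 1) (l + 1) (k + 1) ∪ block (a' + 1) b' (k + 1) (l + 1)).ncard =
      (l + 1) * (k + 1) + (k + 1) * (l + 1) := by
    rw [Set.ncard_union_eq ?_ (finite_block _ _ _ _) (finite_block _ _ _ _), ncard_block,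
      ncard_block]
    rw [Set.disjoint_left]
    rintro ⟨x, y⟩ h1 h2
    -- A common centre would have its north vertex in both of the disjoint unions.
    have h3 := (planeComplementary_oddRect k l ha hb).parity _ h1
    refine Set.disjoint_left.1 hd
      (((planeComplementary_oddRect k l ha hb).or_north x y h3.1 h3.2).2 (Or.inl h1))
      (((planeComplementary_oddRect' l k ha' hb').or_north x y h3.1 h3.2).2 (Or.inl h2))
  have hc2 : ((oddRect a b (k + 1) l ∪ oddRect a' b' l (k + 1)) ∩ {p | p.1 % 2 = e}).ncard =
      (l + 1) * (k + 2) + (k + 1) * l := by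
    rw [Set.union_inter_distrib_right, Set.ncard_union_eq ?_ ?_ ?_, oddRect_inter_eq _ _ ha hb,
      oddRect_inter_eq' _ _ ha' hb', ncard_block, ncard_block]
    · exact Disjoint.mono (fun p hp => Or.inl hp.1) (fun p hp => Or.inl hp.1) hd
    · rw [oddRect_inter_eq _ _ ha hb]
      exact finite_block _ _ _ _
    · rw [oddRect_inter_eq' _ _ ha' hb']
      exact finite_block _ _ _ _
  rw [hc1, hc2] at h1
  -- The exponents satisfy k + (l+1)(k+2) + (k+1)l = l + 2(k+1)(l+1).
  exact (mul_pow_eq_of_add_eq (h1.trans (mul_comm _ _) |>.trans (mul_comm _ _)) (by ring))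

end Rectangles

/-! ### Holes and their symmetries -/

theorem Color.opp_opp (c : Color) : c.opp.opp = c := by
  cases c <;> rfl

/-- The sign of the charge of a monomer. -/
def Color.sign : Color → ℤ
  | white => 1
  | black => -1

theorem Color.sign_opp (c : Color) : c.opp.sign = -c.sign := by
  cases c <;> rfl

theorem Hole.vertices_eq (O : Hole) : O.vertices = oddRect O.corner.1 O.corner.2 O.k O.l := rfl

/-- The two colours form blocks of (k+1)(l+1) and kl vertices. -/
theorem Hole.charge_eq (O : Hole) : O.charge = O.color.sign * (O.k + O.l + 1) := by
  have h0 : {p : ℤ × ℤ | Even p.1} = {p | p.1 % 2 = 0} := by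
    ext p
    exact Int.even_iff
  have h1 : {p : ℤ × ℤ | Odd p.1} = {p | p.1 % 2 = 1} := by
    ext p
    exact Int.odd_iff
  rw [Hole.charge, Hole.vertices_eq, h0, h1, Hole.corner]
  rcases O with ⟨⟨c, k, l⟩, p, q⟩
  cases c
  · rw [oddRect_inter_eq k l (e := 0), oddRect_inter_eq' k l (e := 1), ncard_block, ncard_block]
    · simp only [Color.sign]
      push_cast
      ring
    all_goals
      simp only [Color.base]
      omega
  · rw [oddRect_inter_eq' k l (e := 0), oddRect_inter_eq k l (e := 1), ncard_block, ncard_block]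
    · simp only [Color.sign]
      push_cast
      ring
    all_goals
      simp only [Color.base]
      omega

/-- The absolute value of the charge of a hole of a given kind. -/
def HoleKind.size (τ : HoleKind) : ℕ := τ.k + τ.l + 1

theorem HoleKind.charge_place (τ : HoleKind) (x : ℤ × ℤ) :
    (τ.place x).charge = τ.color.sign * τ.size := by
  rw [Hole.charge_eq]
  simp [HoleKind.place, HoleKind.size]

theorem HoleKind.natAbs_charge_place (τ : HoleKind) (x : ℤ × ℤ) :
    (τ.place x).charge.natAbs = τ.size := by
  rw [HoleKind.charge_place, Int.natAbs_mul, Int.natAbs_natCast]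
  cases τ.color <;> simp [Color.sign]

theorem coulomb_congr {r : ℕ} {O O' : Fin r → Hole}
    (hd : ∀ i j, (O' i).dist (O' j) = (O i).dist (O j))
    (hq : ∀ i j, (O' i).charge * (O' j).charge = (O i).charge * (O j).charge) :
    coulomb O' = coulomb O := by
  simp only [coulomb, hd, hq]

theorem coulomb_nonneg {r : ℕ} (O : Fin r → Hole) : 0 ≤ coulomb O :=
  Finset.prod_nonneg fun _ _ => Finset.prod_nonneg fun _ _ =>
    Real.rpow_nonneg (Real.sqrt_nonneg _) _

theorem finiteCorrelation_nonneg (m n : ℕ) {r : ℕ} (O : Fin r → Hole) :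
    0 ≤ finiteCorrelation m n O := by
  unfold finiteCorrelation
  positivity

theorem HasNeutralCorrelation.neutralCorrelation_eq {r : ℕ} {O : Fin r → Hole} {w : ℝ}
    (h : HasNeutralCorrelation O w) : neutralCorrelation O = w :=
  h.limUnder_eq

theorem HasNeutralCorrelation.nonneg {r : ℕ} {O : Fin r → Hole} {w : ℝ}
    (h : HasNeutralCorrelation O w) : 0 ≤ w :=
  ge_of_tendsto' h fun _ => finiteCorrelation_nonneg _ _ _

/-- A symmetry of the square grid that descends to the torus preserves correlations. -/
theorem finiteCorrelation_congr {N r : ℕ} {O O' : Fin r → Hole} (g : ℤ × ℤ ≃ ℤ × ℤ)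
    (e : Torus N ≃ Torus N) (hge : ∀ p, toTorus N N (g p) = e (toTorus N N p))
    (he : ∀ u v, (cornerGraph N N).Adj (e u) (e v) ↔ (cornerGraph N N).Adj u v)
    (hS : ∀ u, e u ∈ toTorus N N '' gridVertices ↔ u ∈ toTorus N N '' gridVertices)
    (hO : ∀ i p, g p ∈ (O' i).vertices ↔ p ∈ (O i).vertices) :
    finiteCorrelation N N O' = finiteCorrelation N N O := by
  have hH : ∀ u, e u ∈ toTorus N N '' (⋃ i, (O' i).vertices) ↔
      u ∈ toTorus N N '' (⋃ i, (O i).vertices) := by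
    intro u
    simp only [Set.mem_image, Set.mem_iUnion]
    constructor
    · rintro ⟨p, ⟨i, hp⟩, hpu⟩
      obtain ⟨q, rfl⟩ := g.surjective p
      rw [hge] at hpu
      exact ⟨q, ⟨i, (hO i q).1 hp⟩, e.injective hpu⟩
    · rintro ⟨p, ⟨i, hp⟩, rfl⟩
      exact ⟨g p, ⟨i, (hO i p).2 hp⟩, hge p⟩
  rw [finiteCorrelation, finiteCorrelation]
  congr 2
  exact numPerfectMatchings_induce_congr _ e he _ _ fun u => and_congr (hS u) (not_congr (hH u))

/-- The holes of kinds `σ` at the positions `y`. -/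
def placeAll {r : ℕ} (σ : Fin r → HoleKind) (y : Fin r → ℤ × ℤ) : Fin r → Hole :=
  fun i => (σ i).place (y i)

theorem finiteCorrelation_translate {r : ℕ} (N : ℕ) (σ : Fin r → HoleKind) (y : Fin r → ℤ × ℤ)
    (v : ℤ × ℤ) : finiteCorrelation N N (placeAll σ fun i => y i + v) =
      finiteCorrelation N N (placeAll σ y) := by
  refine finiteCorrelation_congr (Equiv.addRight (2 * v.1, 2 * v.2))
    (Equiv.addRight (toTorus N N (2 * v.1, 2 * v.2))) ?_ ?_ ?_ ?_
  · intro p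
    ext <;> simp [toTorus]
  · intro u w
    simp only [cornerGraph, Equiv.coe_addRight, ne_eq, add_left_inj, Prod.fst_add, Prod.snd_add,
      add_right_comm _ _ (1 : ZMod (2 * N)), add_sub_right_comm]
  · intro u
    rw [mem_image_gridVertices, mem_image_gridVertices]
    simp only [Equiv.coe_addRight, toTorus, Prod.fst_add, Prod.snd_add, map_add, par_intCast]
    push_cast
    have h : (2 : ZMod 2) = 0 := rfl
    rw [h, zero_mul, zero_mul, add_zero, add_zero]
  · rintro i ⟨p, q⟩
    change (p + 2 * v.1, q + 2 * v.2) ∈ _ ↔ _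
    rw [Hole.vertices_eq, Hole.vertices_eq, mem_oddRect, mem_oddRect]
    simp only [placeAll, HoleKind.place, Hole.corner, Prod.fst_add, Prod.snd_add]
    omega

theorem dist_placeAll_translate {r : ℕ} (σ : Fin r → HoleKind) (y : Fin r → ℤ × ℤ)
    (v : ℤ × ℤ) (i j : Fin r) : (placeAll σ (fun i => y i + v) i).dist
      (placeAll σ (fun i => y i + v) j) = (placeAll σ y i).dist (placeAll σ y j) := by
  simp only [Hole.dist, Hole.center, Hole.corner, placeAll, HoleKind.place, Prod.fst_add,
    Prod.snd_add]
  congr 4 <;> push_cast <;> ring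

theorem coulomb_translate {r : ℕ} (σ : Fin r → HoleKind) (y : Fin r → ℤ × ℤ) (v : ℤ × ℤ) :
    coulomb (placeAll σ fun i => y i + v) = coulomb (placeAll σ y) :=
  coulomb_congr (dist_placeAll_translate σ y v) fun i j => by
    simp only [placeAll, HoleKind.charge_place]

theorem neutralCorrelation_translate {r : ℕ} (σ : Fin r → HoleKind) (y : Fin r → ℤ × ℤ)
    (v : ℤ × ℤ) : neutralCorrelation (placeAll σ fun i => y i + v) =
      neutralCorrelation (placeAll σ y) := by
  simp only [neutralCorrelation, finiteCorrelation_translate]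

/-- The mirror image of a hole with respect to the diagonal. -/
def HoleKind.swap (τ : HoleKind) : HoleKind := ⟨τ.color.opp, τ.l, τ.k⟩

theorem HoleKind.size_swap (τ : HoleKind) : τ.swap.size = τ.size := by
  simp only [HoleKind.size, HoleKind.swap, add_comm τ.l]

theorem HoleKind.charge_swap (τ : HoleKind) (x y : ℤ × ℤ) :
    (τ.swap.place x).charge = -(τ.place y).charge := by
  rw [HoleKind.charge_place, HoleKind.charge_place, HoleKind.size_swap, HoleKind.swap,
    Color.sign_opp, neg_mul]

/-- The reflection preserves the torus because it is square, and exchanges the colours because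
exactly one coordinate of a vertex is even. -/
theorem finiteCorrelation_swap {r : ℕ} (N : ℕ) (σ : Fin r → HoleKind) (y : Fin r → ℤ × ℤ) :
    finiteCorrelation N N (placeAll (fun i => (σ i).swap) fun i => (y i).swap) =
      finiteCorrelation N N (placeAll σ y) := by
  refine finiteCorrelation_congr (Equiv.prodComm ℤ ℤ) (Equiv.prodComm _ _) ?_ ?_ ?_ ?_
  · intro p
    rfl
  · intro u w
    simp only [cornerGraph, Equiv.prodComm_apply, ne_eq, Prod.swap_inj, Prod.fst_swap,
      Prod.snd_swap]
    tauto
  · intro u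
    rw [mem_image_gridVertices, mem_image_gridVertices, add_comm]
    rfl
  · rintro i ⟨p, q⟩
    rw [Hole.vertices_eq, Hole.vertices_eq, Equiv.prodComm_apply, Prod.swap_prod_mk, mem_oddRect,
      mem_oddRect]
    simp only [placeAll, HoleKind.place, HoleKind.swap, Hole.corner, Prod.fst_swap, Prod.snd_swap]
    cases (σ i).color <;> simp only [Color.opp, Color.base] <;> omega

theorem coulomb_swap {r : ℕ} (σ : Fin r → HoleKind) (y : Fin r → ℤ × ℤ) :
    coulomb (placeAll (fun i => (σ i).swap) fun i => (y i).swap) = coulomb (placeAll σ y) := by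
  refine coulomb_congr (fun i j => ?_) fun i j => ?_
  · have h : ∀ (τ : HoleKind) (x : ℤ × ℤ),
        (τ.swap.place x.swap).center = (τ.place x).center.swap := by
      rintro ⟨c, k, l⟩ x
      cases c <;> rfl
    simp only [Hole.dist, placeAll, h, Prod.fst_swap, Prod.snd_swap]
    rw [add_comm]
  · simp only [placeAll]
    rw [HoleKind.charge_swap _ _ (y i), HoleKind.charge_swap _ _ (y j), neg_mul_neg]

theorem neutralCorrelation_swap {r : ℕ} (σ : Fin r → HoleKind) (y : Fin r → ℤ × ℤ) :
    neutralCorrelation (placeAll (fun i => (σ i).swap) fun i => (y i).swap) =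
      neutralCorrelation (placeAll σ y) := by
  simp only [neutralCorrelation, finiteCorrelation_swap]

/-! ### Large separations -/

theorem tendsto_farApart {α : Type*} {r : ℕ} {f : α → Fin r → ℤ × ℤ} {l : Filter α} :
    Tendsto f l (farApart r) ↔
      ∀ i j, i ≠ j → Tendsto (fun a => Dist.dist (f a i) (f a j)) l atTop := by
  simp only [farApart, tendsto_iInf, tendsto_comap_iff]
  rfl

theorem tendsto_dist_farApart {r : ℕ} {i j : Fin r} (h : i ≠ j) :
    Tendsto (fun x : Fin r → ℤ × ℤ => Dist.dist (x i) (x j)) (farApart r) atTop :=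
  tendsto_farApart.1 tendsto_id i j h

theorem tendsto_farApart_of_dist_le {r : ℕ} (S : (Fin r → ℤ × ℤ) → Fin r → ℤ × ℤ) (b : ℝ)
    (hS : ∀ y i, Dist.dist (S y i) (y i) ≤ b) : Tendsto S (farApart r) (farApart r) := by
  rw [tendsto_farApart]
  intro i j hij
  refine tendsto_atTop_mono (fun y => ?_)
    (tendsto_atTop_add_const_right _ (-(2 * b)) (tendsto_dist_farApart hij))
  have h1 := dist_triangle4 (y i) (S y i) (S y j) (y j)
  have h2 := hS y i
  have h3 := hS y j
  rw [dist_comm] at h2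
  linarith

/-- Points on a horizontal line, at mutual distances at least `n`. -/
def spread (s n : ℕ) : Fin s → ℤ × ℤ := fun i => (n * (i + 1), 0)

theorem tendsto_cons_spread (s : ℕ) :
    Tendsto (fun n => (Fin.cons 0 (spread s n) : Fin (s + 1) → ℤ × ℤ)) atTop
      (farApart (s + 1)) := by
  have h : ∀ n, (Fin.cons 0 (spread s n) : Fin (s + 1) → ℤ × ℤ) =
      fun i : Fin (s + 1) => ((n : ℤ) * ((i : ℕ) : ℤ), (0 : ℤ)) := by
    intro n
    funext i
    refine Fin.cases ?_ (fun i => ?_) i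
    · simp only [Fin.cons_zero, Fin.val_zero, Nat.cast_zero, mul_zero]
      rfl
    · simp [spread]
  simp only [h]
  rw [tendsto_farApart]
  intro i j hij
  refine tendsto_atTop_mono (fun n : ℕ => ?_) tendsto_natCast_atTop_atTop
  rw [Prod.dist_eq]
  refine le_trans ?_ (le_max_left _ _)
  simp only [Int.dist_eq]
  have h1 : (1 : ℝ) ≤ |((i : ℕ) : ℝ) - ((j : ℕ) : ℝ)| := by
    have h2 : ((i : ℕ) : ℤ) - ((j : ℕ) : ℤ) ≠ 0 := by
      have := Fin.val_ne_of_ne hij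
      omega
    have := Int.one_le_abs h2
    exact_mod_cast this
  push_cast
  rw [← mul_sub, abs_mul, Nat.abs_cast]
  exact le_mul_of_one_le_right (Nat.cast_nonneg n) h1

/-- Nontriviality of these filters is what makes limits along them unique. -/
instance farApart_succ_neBot (s : ℕ) : (farApart (s + 1)).NeBot :=
  (tendsto_cons_spread s).neBot

instance comap_cons_farApart_neBot (s : ℕ) :
    (comap (fun x => (Fin.cons 0 x : Fin (s + 1) → ℤ × ℤ)) (farApart (s + 1))).NeBot :=
  Tendsto.neBot (f := spread s) (x := atTop) <| tendsto_comap_iff.2 <| by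
    exact tendsto_cons_spread s

/-! ### The correlation of a single hole -/

/-- A hole together with `s` monomers of the opposite colour. -/
def screened (τ : HoleKind) (s : ℕ) : Fin (s + 1) → HoleKind :=
  Fin.cons τ fun _ => ⟨τ.color.opp, 0, 0⟩

theorem neutralized_eq_placeAll (O : Hole) (x : Fin O.charge.natAbs → ℤ × ℤ) :
    neutralized O x = placeAll (screened O.toHoleKind O.charge.natAbs) (Fin.cons O.pos x) := by
  funext i
  refine Fin.cases ?_ (fun i => ?_) i <;> rfl

def screenedCorrelation (τ : HoleKind) (s : ℕ) (y : Fin (s + 1) → ℤ × ℤ) : ℝ :=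
  neutralCorrelation (placeAll (screened τ s) y) /
    (monomerCorrelation ^ s * coulomb (placeAll (screened τ s) y))

theorem normalizedCorrelation_eq (O : Hole) (x : Fin O.charge.natAbs → ℤ × ℤ) :
    normalizedCorrelation O x =
      screenedCorrelation O.toHoleKind O.charge.natAbs (Fin.cons O.pos x) := by
  rw [normalizedCorrelation, neutralized_eq_placeAll, screenedCorrelation]

theorem screenedCorrelation_translate (τ : HoleKind) (s : ℕ) (y : Fin (s + 1) → ℤ × ℤ)
    (v : ℤ × ℤ) : screenedCorrelation τ s (fun i => y i + v) = screenedCorrelation τ s y := by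
  simp only [screenedCorrelation, coulomb_translate, neutralCorrelation_translate]

theorem screenedCorrelation_swap (τ : HoleKind) (s : ℕ) (y : Fin (s + 1) → ℤ × ℤ) :
    screenedCorrelation τ.swap s (fun i => (y i).swap) = screenedCorrelation τ s y := by
  have h : screened τ.swap s = fun i => (screened τ s i).swap := by
    funext i
    refine Fin.cases ?_ (fun i => ?_) i <;> rfl
  simp only [screenedCorrelation, h, coulomb_swap, neutralCorrelation_swap]

theorem correlation_place (τ : HoleKind) (x : ℤ × ℤ) :
    correlation (τ.place x) =
      limUnder (comap (fun z => (Fin.cons x z : Fin (τ.size + 1) → ℤ × ℤ)) (farApart (τ.size + 1)))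
        fun z => screenedCorrelation τ τ.size (Fin.cons x z) := by
  rw [← τ.natAbs_charge_place x, correlation]
  congr 1
  funext z
  exact normalizedCorrelation_eq _ z

theorem comap_translate_farApart (r : ℕ) (v : ℤ × ℤ) :
    comap (fun y : Fin r → ℤ × ℤ => fun i => y i + v) (farApart r) = farApart r := by
  simp only [farApart, comap_iInf, comap_comap]
  simp [Function.comp_def]

/-- No existence of the limit is assumed: translation carries one filter and function to the other,
so both sides are `lim` of the same filter. This turns the product in the conjecture into a
constant. -/
theorem correlation_place_eq (τ : HoleKind) (x : ℤ × ℤ) :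
    correlation (τ.place x) = correlation (τ.place 0) := by
  rw [correlation_place, correlation_place, limUnder, limUnder]
  refine congrArg lim ?_
  let e : (Fin τ.size → ℤ × ℤ) ≃ (Fin τ.size → ℤ × ℤ) := Equiv.addRight fun _ => x
  have h : ∀ z, (Fin.cons x (e z) : Fin (τ.size + 1) → ℤ × ℤ) =
      fun i => (Fin.cons 0 z : Fin (τ.size + 1) → ℤ × ℤ) i + x := by
    intro z
    funext i
    refine Fin.cases ?_ (fun i => ?_) i
    · simp
    · simp [e]
  have h1 : comap (fun z => (Fin.cons 0 z : Fin (τ.size + 1) → ℤ × ℤ)) (farApart (τ.size + 1)) =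
      comap e (comap (fun z => (Fin.cons x z : Fin (τ.size + 1) → ℤ × ℤ))
        (farApart (τ.size + 1))) := by
    rw [comap_comap, Function.comp_def]
    simp only [h]
    conv_lhs => rw [← comap_translate_farApart _ x, comap_comap]
    rfl
  rw [h1]
  conv_lhs => rw [← map_comap_of_surjective e.surjective (comap _ _), map_map]
  refine congrArg (fun f => map f _) ?_
  funext z
  simp only [Function.comp_apply, h]
  exact screenedCorrelation_translate _ _ _ _

/-! ### Consequences of the electrostatic conjecture -/

/-- The correlation of a hole, as a function of its kind. -/
def HoleKind.correlation (τ : HoleKind) : ℝ := AztecWindow.correlation (τ.place 0)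

namespace ElectrostaticConjecture

theorem eventually_hasNeutralCorrelation (hEC : ElectrostaticConjecture) {r : ℕ}
    {σ : Fin r → HoleKind} (hσ : ∑ i, ((σ i).place 0).charge = 0) :
    ∀ᶠ x in farApart r, ∃ w, HasNeutralCorrelation (placeAll σ x) w :=
  (hEC r σ hσ).1

theorem prod_ne_zero_and_tendsto (hEC : ElectrostaticConjecture) {s : ℕ}
    {σ : Fin (s + 1) → HoleKind} (hσ : ∑ i, ((σ i).place 0).charge = 0) :
    ∏ i, (σ i).correlation ≠ 0 ∧
      Tendsto (fun x => neutralCorrelation (placeAll σ x) / coulomb (placeAll σ x))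
        (farApart (s + 1)) (𝓝 (∏ i, (σ i).correlation)) := by
  have h := (hEC (s + 1) σ hσ).2
  simp only [correlation_place_eq] at h
  change Tendsto (fun x => neutralCorrelation (placeAll σ x) /
    ((∏ i, (σ i).correlation) * coulomb (placeAll σ x))) _ _ at h
  -- A zero product would make every quotient 0, as division by zero gives 0, contradicting the
  -- limit 1.
  have h0 : ∏ i, (σ i).correlation ≠ 0 := by
    intro h0
    simp only [h0, zero_mul, div_zero] at h
    exact zero_ne_one (tendsto_nhds_unique tendsto_const_nhds h)
  refine ⟨h0, ?_⟩
  have h1 := h.const_mul (∏ i, (σ i).correlation)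
  rw [mul_one] at h1
  refine h1.congr fun x => ?_
  rw [← mul_div_assoc, mul_div_mul_left _ _ h0]

theorem sum_charge_screened (τ : HoleKind) :
    ∑ i, ((screened τ τ.size i).place 0).charge = 0 := by
  rw [Fin.sum_univ_succ]
  change (τ.place 0).charge +
    ∑ _i : Fin τ.size, ((HoleKind.mk τ.color.opp 0 0).place 0).charge = 0
  rw [Finset.sum_const, Finset.card_fin, HoleKind.charge_place, HoleKind.charge_place]
  simp [Color.sign_opp, HoleKind.size]
  ring

theorem prod_screened (τ : HoleKind) (s : ℕ) : ∏ i, (screened τ s i).correlation =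
    τ.correlation * (HoleKind.mk τ.color.opp 0 0).correlation ^ s := by
  rw [Fin.prod_univ_succ]
  simp [screened]

theorem correlation_ne_zero (hEC : ElectrostaticConjecture) (τ : HoleKind) :
    τ.correlation ≠ 0 := by
  have h := (hEC.prod_ne_zero_and_tendsto (sum_charge_screened τ)).1
  rw [prod_screened] at h
  exact left_ne_zero_of_mul h

theorem tendsto_screenedCorrelation_aux (hEC : ElectrostaticConjecture) (τ : HoleKind) :
    Tendsto (screenedCorrelation τ τ.size) (farApart (τ.size + 1))
      (𝓝 (τ.correlation * (HoleKind.mk τ.color.opp 0 0).correlation ^ τ.size /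
        monomerCorrelation ^ τ.size)) := by
  have h := (hEC.prod_ne_zero_and_tendsto (sum_charge_screened τ)).2
  rw [prod_screened] at h
  refine (h.div_const (monomerCorrelation ^ τ.size)).congr fun y => ?_
  rw [screenedCorrelation, div_div, mul_comm]

/-- The conjecture for two opposite monomers evaluates the limit defining the correlation of one of
them. The result is that correlation times the other one over `monomerCorrelation`, and the nonzero
factor cancels. -/
theorem correlation_monomer (hEC : ElectrostaticConjecture) (c : Color) :
    (HoleKind.mk c 0 0).correlation = monomerCorrelation := by
  let τ : HoleKind := ⟨c.opp, 0, 0⟩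
  have h1 : τ.correlation = τ.correlation * (HoleKind.mk τ.color.opp 0 0).correlation ^ τ.size /
      monomerCorrelation ^ τ.size := by
    conv_lhs => rw [HoleKind.correlation, correlation_place]
    exact ((hEC.tendsto_screenedCorrelation_aux τ).comp tendsto_comap).limUnder_eq
  have hsize : τ.size = 1 := rfl
  have hopp : τ.color.opp = c := c.opp_opp
  rw [hsize, hopp, pow_one, pow_one] at h1
  have h0 : τ.correlation ≠ 0 := hEC.correlation_ne_zero τ
  have hm : monomerCorrelation ≠ 0 := by
    intro hm
    rw [hm, div_zero] at h1
    exact h0 h1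
  rw [eq_div_iff hm] at h1
  exact (mul_left_cancel₀ h0 h1).symm

theorem tendsto_screenedCorrelation (hEC : ElectrostaticConjecture) (τ : HoleKind) :
    Tendsto (screenedCorrelation τ τ.size) (farApart (τ.size + 1)) (𝓝 τ.correlation) := by
  have h := hEC.tendsto_screenedCorrelation_aux τ
  have hm : monomerCorrelation ≠ 0 := by
    rw [← hEC.correlation_monomer .white]
    exact hEC.correlation_ne_zero _
  rwa [hEC.correlation_monomer, mul_div_cancel_right₀ _ (pow_ne_zero _ hm)] at h

theorem hasCorrelation (hEC : ElectrostaticConjecture) (O : Hole) :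
    HasCorrelation O (AztecWindow.correlation O) := by
  have hs : O.charge.natAbs = O.toHoleKind.size := O.toHoleKind.natAbs_charge_place O.pos
  have hsum := sum_charge_screened O.toHoleKind
  have hlim := hEC.tendsto_screenedCorrelation O.toHoleKind
  rw [← hs] at hsum hlim
  constructor
  · have h : Tendsto (fun x => (Fin.cons O.pos x : Fin (O.charge.natAbs + 1) → ℤ × ℤ))
        (receding O) (farApart (O.charge.natAbs + 1)) := tendsto_comap
    filter_upwards [h.eventually (hEC.eventually_hasNeutralCorrelation hsum)] with x hx
    rwa [neutralized_eq_placeAll]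
  · have h : AztecWindow.correlation O = O.toHoleKind.correlation :=
      correlation_place_eq O.toHoleKind O.pos
    rw [h]
    refine Tendsto.congr (fun x => (normalizedCorrelation_eq O x).symm) ?_
    exact hlim.comp tendsto_comap

theorem correlation_nonneg (hEC : ElectrostaticConjecture) (τ : HoleKind) :
    0 ≤ τ.correlation := by
  refine ge_of_tendsto (hEC.tendsto_screenedCorrelation τ) ?_
  filter_upwards [hEC.eventually_hasNeutralCorrelation (sum_charge_screened τ)] with y ⟨w, hw⟩
  rw [screenedCorrelation, hw.neutralCorrelation_eq]
  exact div_nonneg hw.nonneg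
    (mul_nonneg (pow_nonneg (Real.sqrt_nonneg _) _) (coulomb_nonneg _))

theorem correlation_swap (hEC : ElectrostaticConjecture) (τ : HoleKind) :
    τ.swap.correlation = τ.correlation := by
  have h1 := hEC.tendsto_screenedCorrelation τ.swap
  rw [HoleKind.size_swap] at h1
  have h2 : Tendsto (fun (y : Fin (τ.size + 1) → ℤ × ℤ) i => (y i).swap) (farApart (τ.size + 1))
      (farApart (τ.size + 1)) := by
    rw [tendsto_farApart]
    intro i j hij
    refine (tendsto_dist_farApart hij).congr fun y => ?_
    rw [Prod.dist_eq, Prod.dist_eq, max_comm]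
    rfl
  refine tendsto_nhds_unique (h1.comp h2) ((hEC.tendsto_screenedCorrelation τ).congr fun y => ?_)
  exact (screenedCorrelation_swap τ τ.size y).symm

end ElectrostaticConjecture

/-! ### Reshaping holes -/

/-- The displacement of the position of a hole of majority colour `c` when it is made one unit
shorter and one unit wider, keeping its centre. -/
def Color.drift : Color → ℤ × ℤ
  | white => (-1, 1)
  | black => (0, 0)

/-- The mirror image neutralizes the pair and has the same correlation, so the pair yields a square.
-/
def mirrorPair (c : Color) (k l : ℕ) : Fin 2 → HoleKind := ![⟨c, k, l⟩, ⟨c.opp, l, k⟩]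

def driftPair (c : Color) (y : Fin 2 → ℤ × ℤ) : Fin 2 → ℤ × ℤ := ![y 0 + c.drift, y 1 - c.drift]

theorem tendsto_driftPair (c : Color) : Tendsto (driftPair c) (farApart 2) (farApart 2) := by
  refine tendsto_farApart_of_dist_le _ (Dist.dist c.drift 0) fun y i => ?_
  fin_cases i
  · simp [driftPair, dist_eq_norm]
  · simp [driftPair, dist_eq_norm]

theorem sum_charge_mirrorPair (c : Color) (k l : ℕ) :
    ∑ i, ((mirrorPair c k l i).place 0).charge = 0 := by
  simp [mirrorPair, HoleKind.charge_place, Color.sign_opp, HoleKind.size]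
  ring

theorem center_driftPair (c : Color) (k l : ℕ) (y : Fin 2 → ℤ × ℤ) (i : Fin 2) :
    (placeAll (mirrorPair c.opp k (l + 1)) (driftPair c y) i).center =
      (placeAll (mirrorPair c (k + 1) l) y i).center := by
  fin_cases i <;> cases c <;>
    simp [placeAll, mirrorPair, driftPair, HoleKind.place, Hole.center, Hole.corner, Color.base,
      Color.drift, Color.opp] <;> constructor <;> ring

/-- The centres stay in place and both charges change sign, which preserves their product. -/
theorem coulomb_driftPair (c : Color) (k l : ℕ) (y : Fin 2 → ℤ × ℤ) :
    coulomb (placeAll (mirrorPair c.opp k (l + 1)) (driftPair c y)) =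
      coulomb (placeAll (mirrorPair c (k + 1) l) y) := by
  refine coulomb_congr (fun i j => ?_) fun i j => ?_
  · rw [Hole.dist, center_driftPair, center_driftPair, ← Hole.dist]
  · have h : ∀ i, (placeAll (mirrorPair c.opp k (l + 1)) (driftPair c y) i).charge =
        -(placeAll (mirrorPair c (k + 1) l) y i).charge := by
      simp only [placeAll, HoleKind.charge_place]
      refine Fin.forall_fin_two.2 ⟨?_, ?_⟩
      · change c.opp.sign * ((k + (l + 1) + 1 : ℕ) : ℤ) = -(c.sign * ((k + 1 + l + 1 : ℕ) : ℤ))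
        rw [Color.sign_opp]
        push_cast
        ring
      · change c.opp.opp.sign * ((l + 1 + k + 1 : ℕ) : ℤ) =
          -(c.opp.sign * ((l + (k + 1) + 1 : ℕ) : ℤ))
        rw [Color.sign_opp c.opp]
        push_cast
        ring
    rw [h, h, neg_mul_neg]

theorem iUnion_vertices_placeAll_mirrorPair (c : Color) (k l : ℕ) (y : Fin 2 → ℤ × ℤ) :
    ⋃ i, (placeAll (mirrorPair c k l) y i).vertices =
      oddRect (2 * (y 0).1 + c.base.1) (2 * (y 0).2 + c.base.2) k l ∪
      oddRect (2 * (y 1).1 + c.opp.base.1) (2 * (y 1).2 + c.opp.base.2) l k := by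
  ext p
  simp only [Set.mem_iUnion, Fin.exists_fin_two, Set.mem_union]
  rfl

theorem eventually_finiteCorrelation_driftPair (c : Color) (k l : ℕ) {y : Fin 2 → ℤ × ℤ}
    (hy : (2 * k + 2 * l + 8 : ℤ) ≤ |(y 0).1 - (y 1).1| ∨
      (2 * k + 2 * l + 8 : ℤ) ≤ |(y 0).2 - (y 1).2|) :
    ∀ᶠ N : ℕ in atTop,
      finiteCorrelation N N (placeAll (mirrorPair c.opp k (l + 1)) (driftPair c y)) * 2 ^ k =
        2 ^ l * finiteCorrelation N N (placeAll (mirrorPair c (k + 1) l) y) := by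
  have hd : Disjoint
      (oddRect (2 * (y 0).1 + c.base.1) (2 * (y 0).2 + c.base.2) (k + 1) l ∪
        oddRect (2 * (y 0).1 + c.base.1 - 1) (2 * (y 0).2 + c.base.2 + 1) k (l + 1))
      (oddRect (2 * (y 1).1 + c.opp.base.1) (2 * (y 1).2 + c.opp.base.2) l (k + 1) ∪
        oddRect (2 * (y 1).1 + c.opp.base.1 + 1) (2 * (y 1).2 + c.opp.base.2 - 1) (l + 1) k) := by
    rw [Set.disjoint_left]
    rintro ⟨p, q⟩ h1 h2
    have hb : 0 ≤ c.base.1 ∧ c.base.1 ≤ 1 ∧ 0 ≤ c.base.2 ∧ c.base.2 ≤ 1 ∧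
        0 ≤ c.opp.base.1 ∧ c.opp.base.1 ≤ 1 ∧ 0 ≤ c.opp.base.2 ∧ c.opp.base.2 ≤ 1 := by
      cases c <;> simp [Color.base, Color.opp]
    rw [le_abs, le_abs] at hy
    have h1' : 2 * (y 0).1 - 1 ≤ p ∧ p ≤ 2 * (y 0).1 + 2 * l + 3 ∧
        2 * (y 0).2 - 1 ≤ q ∧ q ≤ 2 * (y 0).2 + 2 * k + 3 := by
      rcases h1 with h1 | h1 <;> rw [mem_oddRect] at h1 <;> push_cast at h1 <;> omega
    have h2' : 2 * (y 1).1 - 1 ≤ p ∧ p ≤ 2 * (y 1).1 + 2 * k + 3 ∧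
        2 * (y 1).2 - 1 ≤ q ∧ q ≤ 2 * (y 1).2 + 2 * l + 3 := by
      rcases h2 with h2 | h2 <;> rw [mem_oddRect] at h2 <;> push_cast at h2 <;> omega
    omega
  have key : ∀ᶠ N : ℕ in atTop,
      numPerfectMatchings (torusMinus N N
        (⋃ i, (placeAll (mirrorPair c.opp k (l + 1)) (driftPair c y) i).vertices)) * 2 ^ k =
      2 ^ l * numPerfectMatchings (torusMinus N N
        (⋃ i, (placeAll (mirrorPair c (k + 1) l) y i).vertices)) := by
    rw [iUnion_vertices_placeAll_mirrorPair, iUnion_vertices_placeAll_mirrorPair]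
    -- With this parity the north and south vertices of the cells have colour `c`.
    have h := numPerfectMatchings_oddRect (e := c.base.1)
      (by cases c <;> simp [Color.base]) k l
      (by cases c <;> simp only [Color.base] <;> omega)
      (by cases c <;> simp only [Color.base] <;> omega)
      (by cases c <;> simp only [Color.base, Color.opp] <;> omega)
      (by cases c <;> simp only [Color.base, Color.opp] <;> omega) hd
    have h1 : 2 * (driftPair c y 0).1 + c.opp.base.1 = 2 * (y 0).1 + c.base.1 - 1 := by
      change 2 * ((y 0).1 + c.drift.1) + _ = _
      cases c <;> simp only [Color.base, Color.opp, Color.drift] <;> ring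
    have h2 : 2 * (driftPair c y 0).2 + c.opp.base.2 = 2 * (y 0).2 + c.base.2 + 1 := by
      change 2 * ((y 0).2 + c.drift.2) + _ = _
      cases c <;> simp only [Color.base, Color.opp, Color.drift] <;> ring
    have h3 : 2 * (driftPair c y 1).1 + c.opp.opp.base.1 =
        2 * (y 1).1 + c.opp.base.1 + 1 := by
      change 2 * ((y 1).1 - c.drift.1) + _ = _
      cases c <;> simp only [Color.base, Color.opp, Color.drift] <;> ring
    have h4 : 2 * (driftPair c y 1).2 + c.opp.opp.base.2 =
        2 * (y 1).2 + c.opp.base.2 - 1 := by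
      change 2 * ((y 1).2 - c.drift.2) + _ = _
      cases c <;> simp only [Color.base, Color.opp, Color.drift] <;> ring
    rw [h1, h2, h3, h4]
    exact h
  filter_upwards [key] with N hN
  rw [finiteCorrelation, finiteCorrelation, div_mul_eq_mul_div, ← mul_div_assoc]
  congr 1
  exact_mod_cast hN

theorem eventually_far (n : ℕ) : ∀ᶠ y in farApart 2,
    (n : ℤ) ≤ |(y 0).1 - (y 1).1| ∨ (n : ℤ) ≤ |(y 0).2 - (y 1).2| := by
  have h := tendsto_dist_farApart (r := 2) (i := 0) (j := 1) (by decide)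
  filter_upwards [h.eventually_ge_atTop (n : ℝ)] with y hy
  rw [Prod.dist_eq, le_max_iff, Int.dist_eq, Int.dist_eq] at hy
  exact_mod_cast hy

/-! ### Flattening a square hole -/

namespace ElectrostaticConjecture

theorem prod_mirrorPair (hEC : ElectrostaticConjecture) (c : Color) (k l : ℕ) :
    ∏ i, (mirrorPair c k l i).correlation = (HoleKind.mk c k l).correlation ^ 2 := by
  rw [Fin.prod_univ_two, sq]
  congr 1
  exact hEC.correlation_swap ⟨c, k, l⟩

/-- The finite identity passes to N → ∞ at each separated configuration, and then, divided by the
common Coulomb factor, to infinite separation. -/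
theorem sq_correlation_mul_pow (hEC : ElectrostaticConjecture) (c : Color) (k l : ℕ) :
    (HoleKind.mk c.opp k (l + 1)).correlation ^ 2 * 2 ^ k =
      2 ^ l * (HoleKind.mk c (k + 1) l).correlation ^ 2 := by
  have hsum := sum_charge_mirrorPair c (k + 1) l
  have hsum' := sum_charge_mirrorPair c.opp k (l + 1)
  have h1 := (hEC.prod_ne_zero_and_tendsto hsum).2
  have h2 := (hEC.prod_ne_zero_and_tendsto hsum').2.comp (tendsto_driftPair c)
  rw [hEC.prod_mirrorPair] at h1 h2
  refine tendsto_nhds_unique (h2.mul_const (2 ^ k)) ((h1.const_mul (2 ^ l)).congr' ?_)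
  filter_upwards [hEC.eventually_hasNeutralCorrelation hsum,
    (tendsto_driftPair c).eventually (hEC.eventually_hasNeutralCorrelation hsum'),
    eventually_far (2 * k + 2 * l + 8)] with y ⟨w, hw⟩ ⟨w', hw'⟩ hy
  have h : w' * 2 ^ k = 2 ^ l * w := by
    refine tendsto_nhds_unique (Tendsto.mul_const _ hw') ((Tendsto.const_mul _ hw).congr' ?_)
    filter_upwards [eventually_finiteCorrelation_driftPair c k l (by exact_mod_cast hy)] with N hN
    exact hN.symm
  simp only [Function.comp_apply, coulomb_driftPair, hw.neutralCorrelation_eq,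
    hw'.neutralCorrelation_eq]
  rw [← mul_div_assoc, ← h, div_mul_eq_mul_div]

/-- Flattening a hole completely, one unit at a time. -/
theorem sq_correlation_flatten (hEC : ElectrostaticConjecture) (k l : ℕ) (c : Color) :
    ∃ c', (HoleKind.mk c 0 (l + k)).correlation ^ 2 =
      2 ^ (l * k) * (HoleKind.mk c' k l).correlation ^ 2 := by
  induction k generalizing l with
  | zero => exact ⟨c, by simp⟩
  | succ k ih =>
    obtain ⟨c', hc'⟩ := ih (l + 1)
    refine ⟨c'.opp, ?_⟩
    have h := hEC.sq_correlation_mul_pow c'.opp k l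
    rw [Color.opp_opp] at h
    rw [show l + (k + 1) = l + 1 + k by ring, hc']
    -- Here (l+1)k = lk + k, and the reshaping trades 2^k for 2^l.
    calc (2 : ℝ) ^ ((l + 1) * k) * (HoleKind.mk c' k (l + 1)).correlation ^ 2
        = 2 ^ (l * k) * ((HoleKind.mk c' k (l + 1)).correlation ^ 2 * 2 ^ k) := by ring
      _ = 2 ^ (l * (k + 1)) * (HoleKind.mk c'.opp (k + 1) l).correlation ^ 2 := by rw [h]; ring

/-- A square is its own mirror image up to colour, so the unspecified colour produced by flattening
is harmless. -/
theorem correlation_square_color (hEC : ElectrostaticConjecture) (n : ℕ) (c c' : Color) :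
    (HoleKind.mk c n n).correlation = (HoleKind.mk c' n n).correlation := by
  have h := fun c => hEC.correlation_swap ⟨c, n, n⟩
  cases c <;> cases c'
  · rfl
  · exact h .black
  · exact h .white
  · rfl

theorem correlation_square_eq (hEC : ElectrostaticConjecture) (n : ℕ) (c c' : Color) :
    (HoleKind.mk c n n).correlation =
      (2 : ℝ) ^ (-(n : ℝ) ^ 2 / 2) * (HoleKind.mk c' 0 (2 * n)).correlation := by
  obtain ⟨d, hd⟩ := hEC.sq_correlation_flatten n n c'
  rw [hEC.correlation_square_color n d c, ← two_mul] at hd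
  have h2 : ((2 : ℝ) ^ (-(n : ℝ) ^ 2 / 2)) ^ 2 * 2 ^ (n * n) = 1 := by
    rw [← Real.rpow_natCast, ← Real.rpow_mul two_pos.le, ← Real.rpow_natCast _ (n * n),
      ← Real.rpow_add two_pos]
    push_cast
    rw [show -(n : ℝ) ^ 2 / 2 * 2 + n * n = 0 by ring, Real.rpow_zero]
  rw [← sq_eq_sq₀ (hEC.correlation_nonneg _)
    (mul_nonneg (Real.rpow_nonneg two_pos.le _) (hEC.correlation_nonneg _)), mul_pow, hd,
    ← mul_assoc, h2, one_mul]

end ElectrostaticConjecture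

end AztecWindow
end

open AztecWindow in
theorem corollary4p7 (hEC : ElectrostaticConjecture) (n : ℕ) (O P : Hole)
    (hO : O.k = n ∧ O.l = n) (hP : P.k = 0 ∧ P.l = 2 * n) :
    HasCorrelation O (correlation O) ∧ HasCorrelation P (correlation P) ∧
      correlation O = (2 : ℝ) ^ (-(n : ℝ) ^ 2 / 2) * correlation P := by
  refine ⟨hEC.hasCorrelation O, hEC.hasCorrelation P, ?_⟩
  rcases O with ⟨⟨c, k, l⟩, x⟩
  rcases P with ⟨⟨c', k', l'⟩, x'⟩
  dsimp only at hO hP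
  obtain ⟨rfl, rfl⟩ := hO
  obtain ⟨rfl, rfl⟩ := hP
  have h1 : correlation ⟨⟨c, l, l⟩, x⟩ = (HoleKind.mk c l l).correlation :=
    correlation_place_eq _ x
  have h2 : correlation ⟨⟨c', 0, 2 * l⟩, x'⟩ = (HoleKind.mk c' 0 (2 * l)).correlation :=
    correlation_place_eq _ x'
  rw [h1, h2]
  exact hEC.correlation_square_eq _ c c'
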